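/- Let $C$ be a smooth, projective, geometrically irreducible curve over a field $K$ of characteristic $p\ge 0$, and let $F=K(C)$ be its function field. Let $E$ be an elliptic curve over $K$ and let $P\in E(F)\setminus E(K)$ be a point of infinite order. For every positive integer $n$ let $D_n=D_{nP}$ be the divisor on $C$ given by $v(D_{n})=\max\{-\tfrac12 v(x_v(nP)),0\}$ for every discrete valuation $v$ of $F$ that is trivial on $K$ (normalized to have value group $\mathbf Z$; these valuations correspond to the closed points of $C$), where $x_v$ is the $x$-coordinate function of a $v$-minimal Weierstrass equation of $E_F$. A primitive valuation of $D_n$ is a $v$ with $v(D_n)>0$ and $v(D_m)=0$ for all $1\le m<n$. Call $E$ supersingular if $p>0$ and $E(\overline K)$ has no point of order $p$, and ordinary otherwise. Let $n$ be a positive integer. 1. If $p\nmid n$ or $E$ is ordinary, then $D_n$ has a primitive valuation. 2. If $p\mid n$ and $E$ is supersingular, then $D_n=p^2D_{n/p}$, and $D_n$ has no primitive valuation. -/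

import Mathlib

open AlgebraicGeometry CategoryTheory

universe u

namespace EDS

/-! ### Function fields of curves and their places -/

section FunctionField

variable {K : Type u} [Field K]

/-- The canonical ring homomorphism from `K` to the function field `K(C)` of an integral
`K`-scheme `C`. -/
noncomputable def constants {C : Scheme.{u}} [IsIntegral C] (π : C ⟶ Spec (.of K)) :
    K →+* C.functionField :=
  ((Scheme.ΓSpecIso (.of K)).inv ≫ π.appTop ≫ C.presheaf.germ ⊤ (genericPoint C) trivial).hom

/-- The extension `F / K` is (isomorphic to) the function field of the integral `K`-scheme `C`. -/
def IsFunctionFieldOf {C : Scheme.{u}} [IsIntegral C] (π : C ⟶ Spec (.of K))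
    (F : Type u) [Field F] [Algebra K F] : Prop :=
  ∃ e : F ≃+* C.functionField, ∀ a : K, e (algebraMap K F a) = constants π a

variable (K) in
/-- A place of `F / K`: a discrete valuation of `F` that is trivial on `K` and nontrivial on `F`,
given by its valuation ring. If `F` is the function field of a smooth projective curve over `K`,
these are the local rings at the closed points of the curve. -/
structure Place (F : Type u) [Field F] [Algebra K F] where
  /-- The valuation ring of the place. -/
  ring : ValuationSubring F
  algebraMap_mem : ∀ a : K, algebraMap K F a ∈ ring
  isDVR : IsDiscreteValuationRing ring

attribute [instance] Place.isDVR

variable {F : Type u} [Field F] [Algebra K F]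

/-- The normalized (additive) valuation at a place, with values in `ℤ`, on nonzero elements.
At `0` it takes the junk value `0`. -/
noncomputable def Place.ord (v : Place K F) (x : F) : ℤ :=
  -WithZero.log ((IsDiscreteValuationRing.maximalIdeal v.ring).valuation F x)

end FunctionField

/-! ### Elliptic divisibility sequences -/

section EDS

variable {K : Type u} [Field K] {F : Type u} [Field F] [Algebra K F]

/-- A change of variables from the Weierstrass equation `W` to a `v`-minimal one. -/
noncomputable def toMinimal (W : WeierstrassCurve F) (v : Place K F) :
    WeierstrassCurve.VariableChange F :=
  (W.exists_isMinimal v.ring).choose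

/-- The `x`-coordinate, in a `v`-minimal Weierstrass equation, of a point whose `x`-coordinate on
`W` is `x`: a change of variables `(u, r, s, t)` is the substitution `x = u² x' + r`,
`y = u³ y' + u² s x' + t`. -/
noncomputable def minimalX (W : WeierstrassCurve F) (v : Place K F) (x : F) : F :=
  (x - (toMinimal W v).r) / ((toMinimal W v).u : F) ^ 2

/-- The denominator divisor `D_Q` of a nonzero point `Q`, as the function `v ↦ v(D_Q)` on places,
where `v(D_Q) = max {-v(x_v(Q)) / 2, 0}` with `x_v` the `x`-coordinate of a `v`-minimal
Weierstrass equation. (If `x_v(Q) = 0`, both sides are `0`.) It has no meaning for the point at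
infinity, where it is set to `0`. -/
noncomputable def denominator (W : WeierstrassCurve F) : W.toAffine.Point → Place K F → ℚ
  | .zero, _ => 0
  | .some x _ _, v => max (-(1 / 2) * (v.ord (minimalX W v x) : ℚ)) 0

variable (K) in
/-- The elliptic divisibility sequence `D_n = D_{nP}` of divisors of `F / K`. -/
noncomputable def eds [DecidableEq F] (W : WeierstrassCurve F) (P : W.toAffine.Point) (n : ℕ) :
    Place K F → ℚ :=
  denominator W (n • P)

/-- A primitive valuation of the `n`-th term of a sequence of divisors: it occurs in the `n`-th
term and in no term with smaller positive index. -/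
def IsPrimitiveValuation (D : ℕ → Place K F → ℚ) (n : ℕ) (v : Place K F) : Prop :=
  0 < D n v ∧ ∀ m : ℕ, 1 ≤ m → m < n → ¬ 0 < D m v

/-- The `n`-th term of a sequence of divisors has a primitive valuation. -/
def HasPrimitiveValuation (D : ℕ → Place K F → ℚ) (n : ℕ) : Prop :=
  ∃ v : Place K F, IsPrimitiveValuation D n v

end EDS

/-! ### Supersingular and ordinary elliptic curves -/

section Supersingular

variable {K : Type u} [Field K]

open scoped WeierstrassCurve.Affine in
open scoped Classical in
/-- An elliptic curve over a field `K` is supersingular if `K` has positive characteristic `p` and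
the only `p`-torsion point over an algebraic closure of `K` is the point at infinity. -/
def IsSupersingular (E : WeierstrassCurve K) : Prop :=
  0 < ringChar K ∧
    ∀ Q : (E.toAffine⁄(AlgebraicClosure K)).Point, ringChar K • Q = 0 → Q = 0

/-- An elliptic curve is ordinary if it is not supersingular. -/
def IsOrdinary (E : WeierstrassCurve K) : Prop :=
  ¬ IsSupersingular E

end Supersingular

end EDS

/-! Everything rests on writing x(kQ) = A(x(Q)) / B(x(Q)) with coprime A, B in K[X], where for k > 0
A is monic of degree k² and B has smaller degree, with coefficient k² in degree k² - 1
(`exists_isMulPair`). The pairs are built by a recursion from the formulas for the sum and product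
of x(P + Q) and x(P - Q). As E is defined over K, its equation is minimal at every place
(`denominator_some`), so D_Q is half the polar divisor of x(Q).

For part 1, take a point T of order n > 1 over the algebraic closure and let m be the minimal
polynomial of x(T) over K. Since x(P) is transcendental over K, m(x(P)) has a zero v, where x(P)
reduces to a conjugate of x(T). Then v occurs in D_k iff m divides B_k, iff kT = O, so v is
primitive for n. For n = 1 a pole of x(P) serves. Such a T exists because the geometric points form
a divisible group (A - aB has a root for every a) with nonzero l-torsion for each prime l other than
p (B_l is not constant), and for l = p when E is ordinary.

For part 2, supersingularity leaves B_p without roots, hence constant. So x(pQ) is a polynomial of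
degree p² in x(Q), and pole orders are multiplied by p².

Geometry enters twice. Smoothness makes F finite separable over some K(t), which produces places
(`exists_place_mem_nonunits`). Together with geometric irreducibility it makes K algebraically
closed in F, so a nonconstant point has transcendental x. -/

namespace WeierstrassCurve

/-! ### Sum and product of x(P + Q) and x(P - Q) -/

section AddSub

variable {R : Type*} [CommRing R] (W : WeierstrassCurve R)

/-- The form giving `x(P + Q) x(P - Q)` in terms of `(x(P) x(Q) : x(P) + x(Q) : 1)`. -/
def addSubProd (s t u : R) : R := s ^ 2 - W.b₄ * s * u - W.b₆ * t * u - W.b₈ * u ^ 2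

/-- The form giving `x(P + Q) + x(P - Q)` in terms of `(x(P) x(Q) : x(P) + x(Q) : 1)`. -/
def addSubSum (s t u : R) : R := 2 * t * s + W.b₂ * s * u + W.b₄ * t * u + W.b₆ * u ^ 2

/-- The common denominator of `addSubProd` and `addSubSum`. -/
def addSubDenom (s t u : R) : R := t ^ 2 - 4 * s * u

/-- The three forms are the components of `addSubMap`, which has no nontrivial zero on an elliptic
curve. This later gives both nonzero scalars and coprimality. -/
lemma eq_zero_of_addSub_eq_zero [IsReduced R] [W.IsElliptic] {s t u : R}
    (hT : W.addSubProd s t u = 0) (hS : W.addSubSum s t u = 0) (hD : addSubDenom s t u = 0) :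
    s = 0 ∧ t = 0 ∧ u = 0 := by
  by_contra h
  have hx : ![s, t, u] ≠ 0 := by
    intro h0
    exact h ⟨congrFun h0 0, congrFun h0 1, congrFun h0 2⟩
  apply W.addSubMap_ne_zero hx
  funext i
  fin_cases i
  · simpa [addSubMap, addSubProd] using hT
  · simpa [addSubMap, addSubSum] using hS
  · simpa [addSubMap, addSubDenom] using hD

end AddSub

namespace Affine.Point

variable {F : Type*} [Field F] [DecidableEq F] {W : Affine F}

lemma addSub_of_X_ne {x₁ y₁ x₂ y₂ : F} (h₁ : W.Equation x₁ y₁) (h₂ : W.Equation x₂ y₂)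
    (hx : x₁ ≠ x₂) :
    W.addSubSum (x₁ * x₂) (x₁ + x₂) 1 = (x₁ - x₂) ^ 2 *
      (W.addX x₁ x₂ (W.slope x₁ x₂ y₁ y₂) + W.addX x₁ x₂ (W.slope x₁ x₂ y₁ (W.negY x₂ y₂))) ∧
    W.addSubProd (x₁ * x₂) (x₁ + x₂) 1 = (x₁ - x₂) ^ 2 *
      (W.addX x₁ x₂ (W.slope x₁ x₂ y₁ y₂) * W.addX x₁ x₂ (W.slope x₁ x₂ y₁ (W.negY x₂ y₂))) := by
  rw [slope_of_X_ne hx, slope_of_X_ne hx]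
  have hd : x₁ - x₂ ≠ 0 := sub_ne_zero.2 hx
  rw [equation_iff] at h₁ h₂
  simp only [addX, negY, addSubSum, addSubProd, b₂, b₄, b₆, b₈]
  constructor
  · field_simp
    linear_combination (-2) * h₁ - 2 * h₂
  · field_simp
    linear_combination
      (-y₁ ^ 2 - y₁ * W.a₃ + 2 * y₂ ^ 2 + 2 * y₂ * x₂ * W.a₁ + 2 * y₂ * W.a₃ + x₂ * W.a₁ *
        W.a₃ - y₁ * x₁ * W.a₁ - x₁ * x₂ * W.a₁ ^ 2 - x₁ * W.a₁ * W.a₃ + x₁ ^ 2 * W.a₂ - 4 *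
        x₁ * x₂ * W.a₂ + 2 * x₂ ^ 2 * W.a₂ + x₁ ^ 3 - 2 * x₁ ^ 2 * x₂ - 2 * x₁ * x₂ ^ 2 + 2
        * x₂ ^ 3 + x₂ ^ 2 * W.a₁ ^ 2 - x₁ * W.a₄ - W.a₆) * h₁ +
      (-y₂ ^ 2 - y₂ * x₂ * W.a₁ - y₂ * W.a₃ - x₂ * W.a₁ * W.a₃ - x₁ * x₂ * W.a₁ ^ 2 + x₁ *
        W.a₁ * W.a₃ + 4 * x₁ ^ 2 * W.a₂ - 4 * x₁ * x₂ * W.a₂ + x₂ ^ 2 * W.a₂ + 4 * x₁ ^ 3 -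
        2 * x₁ ^ 2 * x₂ - 2 * x₁ * x₂ ^ 2 + x₂ ^ 3 + x₁ ^ 2 * W.a₁ ^ 2 + 2 * x₁ * W.a₄ +
        W.a₆ - x₂ * W.a₄) * h₂

/-- The duplication formula: the sum form specializes to (2y + a₁x + a₃)², the denominator of x(2P).
-/
lemma addSub_self {x y : F} (h : W.Equation x y) (hy : y ≠ W.negY x y) :
    W.addSubSum (x * x) (x + x) 1 ≠ 0 ∧ W.addSubProd (x * x) (x + x) 1 =
      W.addSubSum (x * x) (x + x) 1 * W.addX x x (W.slope x x y y) := by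
  have hd : y - W.negY x y ≠ 0 := sub_ne_zero.2 hy
  have hS : W.addSubSum (x * x) (x + x) 1 = (y - W.negY x y) ^ 2 := by
    rw [equation_iff] at h
    simp only [negY, addSubSum, b₂, b₄, b₆]
    linear_combination (-4) * h
  refine ⟨hS ▸ pow_ne_zero 2 hd, ?_⟩
  rw [hS, slope_of_Y_ne rfl hy, addX]
  field_simp
  rw [equation_iff] at h
  simp only [negY, addSubProd, b₄, b₆, b₈]
  linear_combination (W.a₁ ^ 2 + 4 * W.a₂ + 8 * x) * h

omit [DecidableEq F] in
lemma addSubSum_self_eq_zero {x y : F} (h : W.Equation x y) (hy : y = W.negY x y) :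
    W.addSubSum (x * x) (x + x) 1 = 0 := by
  rw [equation_iff] at h
  simp only [negY] at hy
  simp only [addSubSum, b₂, b₄, b₆]
  linear_combination (-4) * h + (2 * y + W.a₁ * x + W.a₃) * hy

lemma exists_addSub_eq_sym2x_self [W.IsElliptic] (P : W.Point) :
    ∃ c : F, c ≠ 0 ∧
      W.addSubProd (P.sym2x P 0) (P.sym2x P 1) (P.sym2x P 2) = c * (P + P).sym2x (P - P) 0 ∧
      W.addSubSum (P.sym2x P 0) (P.sym2x P 1) (P.sym2x P 2) = c * (P + P).sym2x (P - P) 1 ∧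
      addSubDenom (P.sym2x P 0) (P.sym2x P 1) (P.sym2x P 2) = c * (P + P).sym2x (P - P) 2 := by
  rcases P with _ | ⟨x, y, h⟩
  · exact ⟨1, one_ne_zero, by simp [← zero_def, addSubProd, addSubSum, addSubDenom]⟩
  rw [sub_self]
  simp only [sym2x_some_some, Matrix.cons_val_zero, Matrix.cons_val_one, Matrix.cons_val]
  have hD : addSubDenom (x * x) (x + x) 1 = 0 := by
    simp only [addSubDenom]
    ring
  by_cases hy : y = W.negY x y
  · have hS := addSubSum_self_eq_zero h.1 hy
    -- Here 2P = O, so only the product form survives. It serves as the scalar, being nonzero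
    -- because the three forms have no common zero.
    refine ⟨W.addSubProd (x * x) (x + x) 1, fun hT ↦ ?_, ?_⟩
    · exact one_ne_zero (W.eq_zero_of_addSub_eq_zero hT hS hD).2.2
    · rw [add_self_of_Y_eq hy]
      simp [hS, hD]
  · obtain ⟨hS, hT⟩ := addSub_self h.1 hy
    refine ⟨_, hS, ?_⟩
    rw [add_self_of_Y_ne hy, sym2x_some_zero]
    simp [hT, hD]

/-- The symmetric square of the `x`-coordinate of `(P + Q, P - Q)`, up to a scalar. -/
lemma exists_addSub_eq_sym2x [W.IsElliptic] (P Q : W.Point) :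
    ∃ c : F, c ≠ 0 ∧
      W.addSubProd (P.sym2x Q 0) (P.sym2x Q 1) (P.sym2x Q 2) = c * (P + Q).sym2x (P - Q) 0 ∧
      W.addSubSum (P.sym2x Q 0) (P.sym2x Q 1) (P.sym2x Q 2) = c * (P + Q).sym2x (P - Q) 1 ∧
      addSubDenom (P.sym2x Q 0) (P.sym2x Q 1) (P.sym2x Q 2) = c * (P + Q).sym2x (P - Q) 2 := by
  rcases P with _ | ⟨x₁, y₁, h₁⟩ <;> rcases Q with _ | ⟨x₂, y₂, h₂⟩
  · exact exists_addSub_eq_sym2x_self _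
  · refine ⟨1, one_ne_zero, ?_⟩
    rw [← zero_def, zero_add, zero_sub, sym2x_neg_right]
    simp only [sym2x_zero_some, sym2x_some_some, Matrix.cons_val_zero, Matrix.cons_val_one,
      Matrix.cons_val, addSubProd, addSubSum, addSubDenom]
    refine ⟨?_, ?_, ?_⟩ <;> ring
  · refine ⟨1, one_ne_zero, ?_⟩
    rw [← zero_def, add_zero, sub_zero]
    simp only [sym2x_some_zero, sym2x_some_some, Matrix.cons_val_zero, Matrix.cons_val_one,
      Matrix.cons_val, addSubProd, addSubSum, addSubDenom]
    refine ⟨?_, ?_, ?_⟩ <;> ring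
  by_cases hx : x₁ = x₂
  · rcases (X_eq_iff (h₁ := h₁) (h₂ := h₂)).1 hx with h | h
    · rw [h]
      exact exists_addSub_eq_sym2x_self _
    · rw [h, sym2x_neg_left, neg_add_cancel, ← neg_add', sym2x_neg_right, sym2x_comm 0]
      convert! exists_addSub_eq_sym2x_self (some x₂ y₂ h₂) using 4
      all_goals rw [sub_self]
  · rw [sub_eq_add_neg, neg_some]
    simp only [sym2x_some_some, Matrix.cons_val_zero, Matrix.cons_val_one, Matrix.cons_val]
    obtain ⟨hS, hT⟩ := addSub_of_X_ne h₁.1 h₂.1 hx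
    refine ⟨(x₁ - x₂) ^ 2, pow_ne_zero 2 (sub_ne_zero.2 hx), ?_⟩
    rw [add_of_X_ne hx, add_of_X_ne hx]
    simp only [sym2x_some_some, Matrix.cons_val_zero, Matrix.cons_val_one, Matrix.cons_val]
    refine ⟨hT, hS, ?_⟩
    simp only [addSubDenom]
    ring

end Affine.Point

end WeierstrassCurve

/-! ### Numerator and denominator of multiplication by n -/

namespace WeierstrassCurve

open Polynomial

variable {K : Type u} [Field K]

instance (E : WeierstrassCurve K) [E.IsElliptic] (L : Type*) [Field L] [Algebra K L] :
    WeierstrassCurve.IsElliptic (E.toAffine.baseChange L) :=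
  inferInstanceAs (E.map (algebraMap K L)).IsElliptic

/-- Every element of an algebraically closed field is the `x`-coordinate of a point. -/
lemma exists_nonsingular (W : WeierstrassCurve K) [W.IsElliptic] [IsAlgClosed K] (x : K) :
    ∃ y, W.toAffine.Nonsingular x y := by
  obtain ⟨y, hy⟩ := IsAlgClosed.exists_eval₂_eq_zero (RingHom.id K)
    (Polynomial.X ^ 2 + C (W.a₁ * x + W.a₃) * Polynomial.X -
      C (x ^ 3 + W.a₂ * x ^ 2 + W.a₄ * x + W.a₆)) (by
        have : (Polynomial.X ^ 2 + C (W.a₁ * x + W.a₃) * Polynomial.X -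
          C (x ^ 3 + W.a₂ * x ^ 2 + W.a₄ * x + W.a₆)).degree = 2 := by compute_degree!
        rw [this]
        decide)
  refine ⟨y, (Affine.equation_iff_nonsingular).1 ((Affine.equation_iff ..).2 ?_)⟩
  simp at hy
  linear_combination hy

/-- The polynomials `A` and `B` are a numerator and a denominator for the `x`-coordinate of
multiplication by `n` on `E`. -/
structure IsMulPair (E : WeierstrassCurve K) (n : ℕ) (A B : K[X]) : Prop where
  isCoprime : IsCoprime A B
  monic : A.Monic
  natDegree_left : A.natDegree = n ^ 2
  natDegree_right : (X * B).natDegree ≤ n ^ 2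
  coeff_right : (X * B).coeff (n ^ 2) = (n : K) ^ 2
  smul_some : ∀ {L : Type u} [Field L] [DecidableEq L] [Algebra K L] {x y : L}
    (h : (E.toAffine.baseChange L).Nonsingular x y),
    (n • Affine.Point.some x y h).xRep 0 * aeval x B =
      (n • Affine.Point.some x y h).xRep 1 * aeval x A

variable {E : WeierstrassCurve K}

lemma isMulPair_zero : IsMulPair E 0 1 0 where
  isCoprime := isCoprime_one_left
  monic := monic_one
  natDegree_left := by simp
  natDegree_right := by simp
  coeff_right := by simp
  smul_some h := by simp

lemma isMulPair_one : IsMulPair E 1 X 1 where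
  isCoprime := isCoprime_one_right
  monic := monic_X
  natDegree_left := by simp
  natDegree_right := by simp
  coeff_right := by simp
  smul_some h := by simp

namespace IsMulPair

variable {n : ℕ} {A B A₀ B₀ A₂ B₂ : K[X]}

section Points

variable {L : Type u} [Field L] [DecidableEq L] [Algebra K L] {x y : L}

lemma aeval_ne_zero (hn : IsMulPair E n A B) (x : L) : aeval x A ≠ 0 ∨ aeval x B ≠ 0 := by
  obtain ⟨a, b, hab⟩ := hn.isCoprime
  by_contra! h
  simpa [h.1, h.2] using congr(aeval x $hab)

/-- `smul_some` says that two vectors of length 2 are proportional. Neither is zero, by coprimality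
on one side, so the factor is a nonzero scalar. -/
lemma exists_aeval_eq (hn : IsMulPair E n A B)
    (h : (E.toAffine.baseChange L).Nonsingular x y) :
    ∃ c : L, c ≠ 0 ∧ aeval x A = c * (n • Affine.Point.some x y h).xRep 0 ∧
      aeval x B = c * (n • Affine.Point.some x y h).xRep 1 := by
  have key := hn.smul_some h
  have hne := hn.aeval_ne_zero x
  rcases hP : n • Affine.Point.some x y h with _ | ⟨x', y', h'⟩
  · rw [hP, ← Affine.Point.zero_def] at key
    simp only [Affine.Point.xRep_zero, Matrix.cons_val_zero, one_mul, Matrix.cons_val_one,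
      zero_mul] at key
    exact ⟨aeval x A, by simpa [key] using hne, by simp [← Affine.Point.zero_def],
      by simp [← Affine.Point.zero_def, key]⟩
  · rw [hP] at key
    simp only [Affine.Point.xRep_some, Matrix.cons_val_zero, Matrix.cons_val_one, one_mul] at key
    refine ⟨aeval x B, fun h0 ↦ ?_, by simp [← key, mul_comm], by simp⟩
    rw [h0, mul_zero] at key
    simp [← key, h0] at hne

lemma smul_eq_zero_iff (hn : IsMulPair E n A B)
    (h : (E.toAffine.baseChange L).Nonsingular x y) :
    n • Affine.Point.some x y h = 0 ↔ aeval x B = 0 := by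
  obtain ⟨c, hc, -, hB⟩ := hn.exists_aeval_eq h
  rcases hP : n • Affine.Point.some x y h with _ | ⟨x', y', h'⟩
  · rw [hP] at hB
    simpa [← Affine.Point.zero_def] using hB
  · rw [hP] at hB
    simp [hB, hc]

lemma aeval_eq_of_smul_eq_some (hn : IsMulPair E n A B)
    (h : (E.toAffine.baseChange L).Nonsingular x y) {x' y' : L}
    {h' : (E.toAffine.baseChange L).Nonsingular x' y'}
    (hP : n • Affine.Point.some x y h = Affine.Point.some x' y' h') :
    aeval x B ≠ 0 ∧ x' * aeval x B = aeval x A := by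
  refine ⟨fun h0 ↦ ?_, ?_⟩
  · rw [← hn.smul_eq_zero_iff h, hP] at h0
    exact Affine.Point.some_ne_zero _ h0
  · simpa [hP] using hn.smul_some h

end Points

end IsMulPair

/-- The value of `addSubProd` at the symmetric square of `(A : B)` and `(X : 1)`. -/
noncomputable def mulProd (E : WeierstrassCurve K) (A B : K[X]) : K[X] :=
  (E.map C).addSubProd (A * X) (A + B * X) B

/-- The value of `addSubSum` at the symmetric square of `(A : B)` and `(X : 1)`. -/
noncomputable def mulSum (E : WeierstrassCurve K) (A B : K[X]) : K[X] :=
  (E.map C).addSubSum (A * X) (A + B * X) B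

/-- The value of `addSubDenom` at the symmetric square of `(A : B)` and `(X : 1)`. -/
noncomputable def mulDenom (A B : K[X]) : K[X] :=
  addSubDenom (A * X) (A + B * X) B

section aeval

variable {L : Type u} [Field L] [Algebra K L] (x : L) (A B : K[X])

lemma aeval_mulProd : aeval x (mulProd E A B) = (E.toAffine.baseChange L).addSubProd
    (aeval x A * x) (aeval x A + aeval x B * x) (aeval x B) := by
  simp [mulProd, addSubProd, baseChange, Affine.baseChange]

lemma aeval_mulSum : aeval x (mulSum E A B) = (E.toAffine.baseChange L).addSubSum
    (aeval x A * x) (aeval x A + aeval x B * x) (aeval x B) := by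
  simp [mulSum, addSubSum, baseChange, Affine.baseChange, map_ofNat]

lemma aeval_mulDenom : aeval x (mulDenom A B) = addSubDenom
    (aeval x A * x) (aeval x A + aeval x B * x) (aeval x B) := by
  simp [mulDenom, addSubDenom, map_ofNat]

end aeval

namespace IsMulPair

variable {n : ℕ} {A B A₀ B₀ A₂ B₂ : K[X]} [E.IsElliptic]

section Points

variable {L : Type u} [Field L] [DecidableEq L] [Algebra K L] {x y : L}

/-- The forms `mulProd`, `mulSum` and `mulDenom` compute the symmetric square of the
`x`-coordinates of `(n + 1) P` and `(n - 1) P`. -/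
lemma exists_aeval_mul_eq (hn : IsMulPair E (n + 1) A B)
    (h : (E.toAffine.baseChange L).Nonsingular x y) :
    ∃ c : L, c ≠ 0 ∧
      aeval x (mulProd E A B) = c * ((n + 2) • Affine.Point.some x y h).sym2x
        (n • Affine.Point.some x y h) 0 ∧
      aeval x (mulSum E A B) = c * ((n + 2) • Affine.Point.some x y h).sym2x
        (n • Affine.Point.some x y h) 1 ∧
      aeval x (mulDenom A B) = c * ((n + 2) • Affine.Point.some x y h).sym2x
        (n • Affine.Point.some x y h) 2 := by
  obtain ⟨d, hd, hA, hB⟩ := hn.exists_aeval_eq h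
  obtain ⟨c, hc, h0, h1, h2⟩ := Affine.Point.exists_addSub_eq_sym2x
    ((n + 1) • Affine.Point.some x y h) (.some x y h)
  rw [← succ_nsmul, show (n + 1) • Affine.Point.some x y h - .some x y h =
    n • Affine.Point.some x y h by
      rw [succ_nsmul, add_sub_cancel_right], add_assoc n 1 1, one_add_one_eq_two] at h0 h1 h2
  refine ⟨d ^ 2 * c, mul_ne_zero (pow_ne_zero 2 hd) hc, ?_, ?_, ?_⟩
  all_goals
    simp only [Affine.Point.sym2x, Affine.Point.xRep_some, Matrix.cons_val_zero,
      Matrix.cons_val_one, Matrix.cons_val, addSubProd, addSubSum, addSubDenom, aeval_mulProd,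
      aeval_mulSum, aeval_mulDenom, hA, hB] at h0 h1 h2 ⊢
  · linear_combination d ^ 2 * h0
  · linear_combination d ^ 2 * h1
  · linear_combination d ^ 2 * h2

end Points


/-- The binary quadratic form with coefficients `mulDenom`, `-mulSum`, `mulProd` has x((n + 2)P) and
x(nP) as its roots, and (A₀ : B₀) represents the second. -/
lemma mul_relation (h₀ : IsMulPair E n A₀ B₀) (h₁ : IsMulPair E (n + 1) A B) :
    mulDenom A B * A₀ ^ 2 - mulSum E A B * A₀ * B₀ + mulProd E A B * B₀ ^ 2 = 0 := by
  classical
  -- The identity is checked at every element of the algebraic closure, each being the x-coordinate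
  -- of a point.
  refine Polynomial.map_injective _ (algebraMap K (AlgebraicClosure K)).injective
    (Polynomial.funext fun x ↦ ?_)
  rw [Polynomial.map_zero, eval_zero, eval_map_algebraMap]
  obtain ⟨y, h⟩ := exists_nonsingular (E.toAffine.baseChange (AlgebraicClosure K)) x
  obtain ⟨c, -, hA₀, hB₀⟩ := h₀.exists_aeval_eq h
  obtain ⟨d, -, hT, hS, hD⟩ := h₁.exists_aeval_mul_eq h
  simp only [map_add, map_sub, map_mul, map_pow, hA₀, hB₀, hT, hS, hD, Affine.Point.sym2x,
    Matrix.cons_val_zero, Matrix.cons_val_one, Matrix.cons_val]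
  ring

/-- The quadratic form of `mul_relation` has the root (A₀ : B₀). As A₀ and B₀ are coprime, a Gauss
lemma argument splits off the corresponding linear factor over K[X]; the other factor is the next
pair. -/
lemma exists_next (h₀ : IsMulPair E n A₀ B₀) (h₁ : IsMulPair E (n + 1) A B) :
    ∃ A₂ B₂, mulProd E A B = A₂ * A₀ ∧ mulSum E A B = A₂ * B₀ + B₂ * A₀ ∧
      mulDenom A B = B₂ * B₀ := by
  have key := h₀.mul_relation h₁
  -- This case includes n = 0, where the root is the point at infinity.
  by_cases hB : B₀ = 0
  · have hA : A₀ = 1 := by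
      refine h₀.monic.eq_one_of_isUnit ?_
      simpa [hB, isCoprime_zero_right] using h₀.isCoprime
    exact ⟨mulProd E A B, mulSum E A B, by simp [hA], by simp [hA, hB], by
      simpa [hA, hB] using key⟩
  have hA : A₀ ≠ 0 := h₀.monic.ne_zero
  obtain ⟨B₂, hB₂⟩ : B₀ ∣ mulDenom A B := by
    refine (h₀.isCoprime.symm.pow_right (n := 2)).dvd_of_dvd_mul_right ?_
    exact ⟨mulSum E A B * A₀ - mulProd E A B * B₀, by linear_combination key⟩
  obtain ⟨A₂, hA₂⟩ : A₀ ∣ mulProd E A B := by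
    refine (h₀.isCoprime.pow_right (n := 2)).dvd_of_dvd_mul_right ?_
    exact ⟨mulSum E A B * B₀ - mulDenom A B * A₀, by linear_combination key⟩
  refine ⟨A₂, B₂, by rw [hA₂, mul_comm], ?_, by rw [hB₂, mul_comm]⟩
  rw [hA₂, hB₂] at key
  refine mul_right_cancel₀ (mul_ne_zero hA hB) ?_
  linear_combination -key

/-- At a common zero of A₂ and B₂ all three forms vanish, which forces A and B to vanish there too.
-/
lemma isCoprime_next (h₁ : IsMulPair E (n + 1) A B)
    (hT : mulProd E A B = A₂ * A₀) (hS : mulSum E A B = A₂ * B₀ + B₂ * A₀)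
    (hD : mulDenom A B = B₂ * B₀) : IsCoprime A₂ B₂ := by
  classical
  rw [isCoprime_iff_aeval_ne_zero_of_isAlgClosed _ (AlgebraicClosure K)]
  intro x
  by_contra! h
  have hne := h₁.aeval_ne_zero x
  have := (E.toAffine.baseChange (AlgebraicClosure K)).eq_zero_of_addSub_eq_zero
    (s := aeval x A * x) (t := aeval x A + aeval x B * x) (u := aeval x B)
    (by rw [← aeval_mulProd, hT]; simp [h.1]) (by rw [← aeval_mulSum, hS]; simp [h.1, h.2])
    (by rw [← aeval_mulDenom, hD]; simp [h.2])
  simp [this.2.2] at hne this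
  exact hne this.2

lemma smul_some_next {L : Type u} [Field L] [DecidableEq L] [Algebra K L] {x y : L}
    (h : (E.toAffine.baseChange L).Nonsingular x y)
    (h₀ : IsMulPair E n A₀ B₀) (h₁ : IsMulPair E (n + 1) A B)
    (hT : mulProd E A B = A₂ * A₀) (hS : mulSum E A B = A₂ * B₀ + B₂ * A₀)
    (hD : mulDenom A B = B₂ * B₀) :
    ((n + 2) • Affine.Point.some x y h).xRep 0 * aeval x B₂ =
      ((n + 2) • Affine.Point.some x y h).xRep 1 * aeval x A₂ := by
  obtain ⟨c, hc, hA₀, hB₀⟩ := h₀.exists_aeval_eq h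
  obtain ⟨d, hd, eT, eS, eD⟩ := h₁.exists_aeval_mul_eq h
  rw [hT, map_mul, hA₀] at eT
  rw [hS, map_add, map_mul, map_mul, hA₀, hB₀] at eS
  rw [hD, map_mul, hB₀] at eD
  refine mul_left_cancel₀ (mul_ne_zero hd hc) ?_
  generalize n • Affine.Point.some x y h = Q at *
  -- If nP = O, the product and sum forms determine A₂ and B₂; otherwise the denominator and sum
  -- forms do.
  rcases Q with _ | ⟨x', y', h'⟩
  · simp only [Affine.Point.sym2x, ← Affine.Point.zero_def, Affine.Point.xRep_zero,
      Matrix.cons_val_zero, Matrix.cons_val_one] at eT eS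
    linear_combination ((n + 2) • Affine.Point.some x y h).xRep 1 * (-d) * eT
      + d * ((n + 2) • Affine.Point.some x y h).xRep 0 * eS
  · simp only [Affine.Point.sym2x, Affine.Point.xRep_some,
      Matrix.cons_val_zero, Matrix.cons_val_one, Matrix.cons_val] at eT eS eD
    linear_combination ((n + 2) • Affine.Point.some x y h).xRep 1 * x' * d * eD +
      ((n + 2) • Affine.Point.some x y h).xRep 0 * d * eD
      - ((n + 2) • Affine.Point.some x y h).xRep 1 * d * eS

omit [E.IsElliptic] in
lemma monic_mulProd (h₁ : IsMulPair E n A B) :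
    (mulProd E A B).Monic ∧ (mulProd E A B).natDegree = 2 * n ^ 2 + 2 := by
  have hB : B.natDegree ≤ n ^ 2 := by
    by_cases hB : B = 0
    · simp [hB]
    · have := h₁.natDegree_right
      rw [natDegree_X_mul hB] at this
      lia
  have hA : A.natDegree ≤ n ^ 2 := h₁.natDegree_left.le
  have hm : ((A * X) ^ 2).Monic := (h₁.monic.mul monic_X).pow 2
  have hd : ((A * X) ^ 2).natDegree = 2 * n ^ 2 + 2 := by
    rw [natDegree_pow, natDegree_mul_X h₁.monic.ne_zero, h₁.natDegree_left]
    ring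
  have hR : (-((E.map C).b₄ * (A * X) * B + (E.map C).b₆ * (A + B * X) * B +
      (E.map C).b₈ * B ^ 2)).natDegree ≤ 2 * n ^ 2 + 1 := by
    simp only [map_b₄, map_b₆, map_b₈]
    compute_degree
    grind
  have hlt : (-((E.map C).b₄ * (A * X) * B + (E.map C).b₆ * (A + B * X) * B +
      (E.map C).b₈ * B ^ 2)).degree < ((A * X) ^ 2).degree := by
    rw [degree_eq_natDegree hm.ne_zero, hd]
    exact degree_le_natDegree.trans_lt (by exact_mod_cast Nat.lt_succ_of_le hR)
  have heq : mulProd E A B = (A * X) ^ 2 + -((E.map C).b₄ * (A * X) * B +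
      (E.map C).b₆ * (A + B * X) * B + (E.map C).b₈ * B ^ 2) := by
    rw [mulProd, addSubProd]
    ring
  rw [heq]
  exact ⟨hm.add_of_left hlt, by rw [natDegree_add_eq_left_of_degree_lt hlt, hd]⟩

-- The factor X avoids the exponent n² - 1, so that the bound and the leading coefficient also make
-- sense for n = 0.
omit [E.IsElliptic] in
lemma natDegree_X_mul_mulSum (h₁ : IsMulPair E n A B) :
    (X * mulSum E A B).natDegree ≤ 2 * n ^ 2 + 2 ∧
      (X * mulSum E A B).coeff (2 * n ^ 2 + 2) = 2 * (1 + (n : K) ^ 2) := by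
  have hXB := h₁.natDegree_right
  have hB : B.natDegree ≤ n ^ 2 := by
    by_cases hB : B = 0
    · simp [hB]
    · rw [natDegree_X_mul hB] at hXB
      lia
  have hA : A.natDegree ≤ n ^ 2 := h₁.natDegree_left.le
  have hG : (A + X * B).natDegree ≤ n ^ 2 := natDegree_add_le_of_degree_le hA hXB
  have hH : (A * X ^ 2).natDegree ≤ n ^ 2 + 2 := by compute_degree!
  have hR : ((E.map C).b₂ * (A * X) * (X * B) + (E.map C).b₄ * (A + X * B) * (X * B) +
      (E.map C).b₆ * B * (X * B)).natDegree ≤ 2 * n ^ 2 + 1 := by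
    simp only [map_b₂, map_b₄, map_b₆]
    generalize X * B = Y at *
    compute_degree
    grind
  have heq : X * mulSum E A B = C 2 * ((A + X * B) * (A * X ^ 2)) +
      ((E.map C).b₂ * (A * X) * (X * B) + (E.map C).b₄ * (A + X * B) * (X * B) +
      (E.map C).b₆ * B * (X * B)) := by
    rw [mulSum, addSubSum, C_ofNat]
    ring
  rw [heq]
  constructor
  · refine natDegree_add_le_of_degree_le ((natDegree_C_mul_le _ _).trans
      (natDegree_mul_le_of_le hG hH |>.trans (by lia))) (hR.trans (by lia))
  · rw [coeff_add, coeff_C_mul, show 2 * n ^ 2 + 2 = n ^ 2 + (n ^ 2 + 2) by ring,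
      coeff_mul_add_eq_of_natDegree_le hG hH, coeff_eq_zero_of_natDegree_lt (n := n ^ 2 + (n ^ 2 + 2))
      (hR.trans_lt (by lia)), coeff_add, h₁.coeff_right, coeff_mul_X_pow]
    have : A.coeff (n ^ 2) = 1 := by
      rw [← h₁.natDegree_left]
      exact h₁.monic
    rw [this]
    ring

/-- The recursion step for the multiplication polynomials. -/
lemma next (h₀ : IsMulPair E n A₀ B₀) (h₁ : IsMulPair E (n + 1) A B) :
    ∃ A₂ B₂, IsMulPair E (n + 2) A₂ B₂ := by
  obtain ⟨A₂, B₂, hT, hS, hD⟩ := h₀.exists_next h₁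
  obtain ⟨hTm, hTd⟩ := h₁.monic_mulProd
  have hA₂ : A₂.Monic := Monic.of_mul_monic_right h₀.monic (by rwa [hT] at hTm)
  have hdA₂ : A₂.natDegree = (n + 2) ^ 2 := by
    rw [hT, hA₂.natDegree_mul h₀.monic, h₀.natDegree_left] at hTd
    grind
  have hcA₂ : A₂.coeff ((n + 2) ^ 2) = 1 := by
    rw [← hdA₂]
    exact hA₂
  have hcA₀ : A₀.coeff (n ^ 2) = 1 := by
    rw [← h₀.natDegree_left]
    exact h₀.monic
  obtain ⟨hSd, hSc⟩ := h₁.natDegree_X_mul_mulSum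
  have hdeg : 2 * (n + 1) ^ 2 + 2 = n ^ 2 + (n + 2) ^ 2 := by ring
  rw [hdeg] at hSd hSc
  -- Comparing coefficients in degree n² + (n + 2)² gives 2(1 + (n + 1)²) - n² = (n + 2)².
  have heq : A₀ * (X * B₂) = X * mulSum E A B - (X * B₀) * A₂ := by
    rw [hS]
    ring
  have hd : (A₀ * (X * B₂)).natDegree ≤ n ^ 2 + (n + 2) ^ 2 := by
    rw [heq]
    exact (natDegree_sub_le_of_le hSd (natDegree_mul_le_of_le h₀.natDegree_right hdA₂.le)).trans
      (by simp)
  have hdB₂ : (X * B₂).natDegree ≤ (n + 2) ^ 2 := by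
    by_cases hB₂ : X * B₂ = 0
    · simp [hB₂]
    · rw [h₀.monic.natDegree_mul' hB₂, h₀.natDegree_left] at hd
      lia
  refine ⟨A₂, B₂, ⟨h₁.isCoprime_next hT hS hD, hA₂, hdA₂, hdB₂, ?_, fun h ↦
    smul_some_next h h₀ h₁ hT hS hD⟩⟩
  have hc := congr(coeff $heq (n ^ 2 + (n + 2) ^ 2))
  rw [coeff_mul_add_eq_of_natDegree_le h₀.natDegree_left.le hdB₂, coeff_sub, hSc,
    coeff_mul_add_eq_of_natDegree_le h₀.natDegree_right hdA₂.le, hcA₀, hcA₂, h₀.coeff_right] at hc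
  push_cast at hc ⊢
  linear_combination hc

end IsMulPair

/-- Multiplication by `n` on an elliptic curve is given on `x`-coordinates by coprime polynomials
`A`, of degree `n²`, and `B`, of smaller degree and with coefficient `n²` in degree `n² - 1`. -/
theorem exists_isMulPair (E : WeierstrassCurve K) [E.IsElliptic] (n : ℕ) :
    ∃ A B, IsMulPair E n A B := by
  induction n using Nat.twoStepInduction with
  | zero => exact ⟨_, _, isMulPair_zero⟩
  | one => exact ⟨_, _, isMulPair_one⟩
  | more n h₀ h₁ =>
    obtain ⟨_, _, h₀⟩ := h₀
    obtain ⟨_, _, h₁⟩ := h₁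
    exact h₀.next h₁

end WeierstrassCurve

/-! ### Points of given order over an algebraically closed field -/

/-- A divisible group with an element of order `l` for every prime factor `l` of `n` has an
element of order `n`. -/
lemma exists_addOrderOf_eq_of_divisible {G : Type*} [AddCommGroup G]
    (hdiv : ∀ l : ℕ, l.Prime → ∀ T : G, ∃ R, l • R = T) (n : ℕ) (hn : 0 < n)
    (h : ∀ l : ℕ, l.Prime → l ∣ n → ∃ R : G, R ≠ 0 ∧ l • R = 0) : ∃ T : G, addOrderOf T = n := by
  induction n using Nat.recOnPosPrimePosCoprime with
  | zero => simp at hn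
  | one => exact ⟨0, by simp⟩
  | prime_pow l k hl hk =>
    clear hn
    have := Fact.mk hl
    obtain ⟨R, hR, hlR⟩ := h l hl (dvd_pow_self l hk.ne')
    clear h
    obtain ⟨k, rfl⟩ := Nat.exists_eq_succ_of_ne_zero hk.ne'
    clear hk
    -- R has order l; dividing it k times by l gives an element of order l^(k + 1).
    suffices ∃ T : G, l ^ k • T = R by
      obtain ⟨T, rfl⟩ := this
      exact ⟨T, addOrderOf_eq_prime_pow hR (by rw [pow_succ', mul_smul, hlR])⟩
    clear hR hlR
    induction k generalizing R with
    | zero => exact ⟨R, by simp⟩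
    | succ k ih =>
      obtain ⟨S, rfl⟩ := hdiv l hl R
      obtain ⟨T, rfl⟩ := ih S
      exact ⟨T, by rw [pow_succ', mul_smul]⟩
  | coprime a b ha hb hab iha ihb =>
    obtain ⟨S, hS⟩ := iha (by lia) fun l hl hla ↦ h l hl (hla.mul_right b)
    obtain ⟨T, hT⟩ := ihb (by lia) fun l hl hlb ↦ h l hl (hlb.mul_left a)
    refine ⟨S + T, ?_⟩
    rw [(AddCommute.all S T).addOrderOf_add_eq_mul_addOrderOf_of_coprime (by rwa [hS, hT]), hS, hT]

namespace WeierstrassCurve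

open Polynomial

variable {K : Type u} [Field K] {E : WeierstrassCurve K}

namespace IsMulPair

variable {n : ℕ} {A B : K[X]}

lemma natDegree_right_lt (h : IsMulPair E n A B) (hn : 0 < n) : B.natDegree < n ^ 2 := by
  by_cases hB : B = 0
  · simp [hB, hn]
  · have := h.natDegree_right
    rw [natDegree_X_mul hB] at this
    lia

lemma degree_right_lt (h : IsMulPair E n A B) (hn : 0 < n) : B.degree < A.degree := by
  rw [degree_eq_natDegree h.monic.ne_zero, h.natDegree_left]
  exact degree_le_natDegree.trans_lt (by exact_mod_cast h.natDegree_right_lt hn)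

end IsMulPair

variable (L : Type u) [Field L] [DecidableEq L] [Algebra K L] [IsAlgClosed L] (E) [E.IsElliptic]

/-- Multiplication by `n` is surjective on the points of an elliptic curve over an algebraically
closed field. -/
lemma exists_smul_eq {n : ℕ} (hn : 0 < n) (T : (E.toAffine.baseChange L).Point) :
    ∃ R, n • R = T := by
  rcases T with _ | ⟨a, b, hT⟩
  · exact ⟨0, by simp [← Affine.Point.zero_def]⟩
  obtain ⟨A, B, h⟩ := E.exists_isMulPair n
  -- A preimage has as x-coordinate a root of A - aB, which has degree n² > 0.
  have hdeg : (A.map (algebraMap K L) - C a * B.map (algebraMap K L)).degree = A.degree := by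
    rw [degree_sub_eq_left_of_degree_lt, degree_map]
    rw [degree_map]
    refine (degree_mul_le _ _).trans_lt ((add_le_add degree_C_le le_rfl).trans_lt ?_)
    rw [degree_map, zero_add]
    exact h.degree_right_lt hn
  obtain ⟨x, hx⟩ := IsAlgClosed.exists_root
    (A.map (algebraMap K L) - C a * B.map (algebraMap K L)) (by
      rw [hdeg, degree_eq_natDegree h.monic.ne_zero, h.natDegree_left]
      exact_mod_cast (pow_pos hn 2).ne')
  have hx : aeval x A = a * aeval x B := by
    simpa [sub_eq_zero, eval_map_algebraMap] using hx
  have hB : aeval x B ≠ 0 := fun h0 ↦ by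
    have := h.aeval_ne_zero x
    simp [hx, h0] at this
  obtain ⟨y, hxy⟩ := exists_nonsingular (E.toAffine.baseChange L) x
  rcases hP : n • Affine.Point.some x y hxy with _ | ⟨x', y', h'⟩
  · exact absurd ((h.smul_eq_zero_iff hxy).1 hP) hB
  · have hx' : x' = a := mul_right_cancel₀ hB ((h.aeval_eq_of_smul_eq_some hxy hP).2.trans hx)
    -- Equal x-coordinates determine the image only up to sign.
    rcases (Affine.Point.X_eq_iff (h₁ := h') (h₂ := hT)).1 hx' with e | e
    · exact ⟨_, hP.trans e⟩
    · exact ⟨-Affine.Point.some x y hxy, by rw [smul_neg, hP, e, neg_neg]⟩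

/-- An elliptic curve over an algebraically closed field has nontrivial `n`-torsion for `n > 1` not
divisible by the characteristic. -/
lemma exists_ne_zero_smul_eq_zero {n : ℕ} (hn : 1 < n) (hnK : (n : K) ≠ 0) :
    ∃ R : (E.toAffine.baseChange L).Point, R ≠ 0 ∧ n • R = 0 := by
  obtain ⟨A, B, h⟩ := E.exists_isMulPair n
  have hc : (X * B).coeff (n ^ 2) ≠ 0 := h.coeff_right ▸ pow_ne_zero 2 hnK
  have hB : B ≠ 0 := fun h0 ↦ by simp [h0] at hc
  have hd := le_natDegree_of_ne_zero hc
  rw [natDegree_X_mul hB] at hd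
  obtain ⟨x, hx⟩ := IsAlgClosed.exists_root (B.map (algebraMap K L)) (by
    rw [degree_map, degree_eq_natDegree hB]
    have : 1 < n ^ 2 := Nat.one_lt_pow two_ne_zero hn
    exact_mod_cast (show B.natDegree ≠ 0 by lia))
  obtain ⟨y, hxy⟩ := exists_nonsingular (E.toAffine.baseChange L) x
  refine ⟨.some x y hxy, Affine.Point.some_ne_zero _, (h.smul_eq_zero_iff hxy).2 ?_⟩
  simpa [eval_map_algebraMap] using hx

/-- An elliptic curve over an algebraically closed field has a point of order `n` if it has
nontrivial `p`-torsion or `n` is not divisible by the characteristic `p`. -/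
lemma exists_addOrderOf_eq (p : ℕ) [CharP K p] {n : ℕ} (hn : 0 < n)
    (h : p.Prime → p ∣ n → ∃ R : (E.toAffine.baseChange L).Point, R ≠ 0 ∧ p • R = 0) :
    ∃ T : (E.toAffine.baseChange L).Point, addOrderOf T = n := by
  refine exists_addOrderOf_eq_of_divisible (fun l hl ↦ E.exists_smul_eq L hl.pos) n hn
    fun l hl hln ↦ ?_
  by_cases hlK : (l : K) = 0
  · rw [CharP.cast_eq_zero_iff K p, hl.dvd_iff_eq (CharP.char_ne_one K p)] at hlK
    subst hlK
    exact h hl hln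
  · exact E.exists_ne_zero_smul_eq_zero L hl.one_lt hlK

/-- If an elliptic curve has no nontrivial `n`-torsion over an algebraically closed field, then
multiplication by `n` is given on `x`-coordinates by a polynomial. -/
lemma IsMulPair.eq_C_of_torsion_eq_zero {n : ℕ} {A B : K[X]} (h : IsMulPair E n A B)
    (htors : ∀ R : (E.toAffine.baseChange L).Point, n • R = 0 → R = 0) :
    ∃ c, c ≠ 0 ∧ B = C c := by
  -- A root of B would be the x-coordinate of a nonzero n-torsion point.
  have hroot : ∀ x : L, aeval x B ≠ 0 := fun x hx ↦ by
    obtain ⟨y, hxy⟩ := exists_nonsingular (E.toAffine.baseChange L) x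
    exact Affine.Point.some_ne_zero _ (htors _ ((h.smul_eq_zero_iff hxy).2 hx))
  have hd : (B.map (algebraMap K L)).degree = 0 := by
    by_contra hd
    obtain ⟨x, hx⟩ := IsAlgClosed.exists_root _ hd
    exact hroot x (by simpa [eval_map_algebraMap] using hx)
  rw [degree_map] at hd
  obtain ⟨c, hc⟩ := (Polynomial.isUnit_iff).1 (Polynomial.isUnit_iff_degree_eq_zero.2 hd)
  exact ⟨c, hc.1.ne_zero, hc.2.symm⟩

end WeierstrassCurve

/-! ### Existence and discreteness of places -/

namespace EDS

open IntermediateField IsDedekindDomain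

variable {K : Type u} [Field K] {F : Type u} [Field F] [Algebra K F]

/-- A valuation subring containing a Dedekind domain with fraction field `F` is a discrete
valuation ring, unless it is `F`. -/
lemma isDiscreteValuationRing_of_isDedekindDomain {B : Type*} [CommRing B] [IsDedekindDomain B]
    [Algebra B F] [IsFractionRing B F] (V : ValuationSubring F) (hBV : ∀ b : B, algebraMap B F b ∈ V)
    (hV : V ≠ ⊤) : IsDiscreteValuationRing V := by
  let φ : B →+* V := (algebraMap B F).codRestrict V.toSubring hBV
  have hφ : ∀ b, (φ b : F) = algebraMap B F b := fun _ ↦ rfl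
  have hinv : ∀ b : B, b ∉ (IsLocalRing.maximalIdeal V).comap φ → (algebraMap B F b)⁻¹ ∈ V := by
    intro b hb
    rw [Ideal.mem_comap, IsLocalRing.notMem_maximalIdeal] at hb
    obtain ⟨c, hc⟩ := isUnit_iff_exists_inv.1 hb
    have : algebraMap B F b * (c : F) = 1 := by
      rw [← hφ]
      exact congr(($hc : F))
    rw [← eq_inv_of_mul_eq_one_right this]
    exact c.2
  -- The centre of V on B is nonzero, since otherwise V would contain every fraction.
  let p : HeightOneSpectrum B := ⟨(IsLocalRing.maximalIdeal V).comap φ, inferInstance, fun h ↦ by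
    refine hV (top_le_iff.1 fun x _ ↦ ?_)
    obtain ⟨a, b, hb, rfl⟩ := IsFractionRing.div_surjective B x
    rw [div_eq_mul_inv]
    exact V.mul_mem _ _ (hBV a) (hinv b (by simpa [h] using nonZeroDivisors.ne_zero hb))⟩
  have hle : (p.valuation F).valuationSubring ≤ V := fun x hx ↦ by
    obtain ⟨a, d, had⟩ := p.exists_primeCompl_mul_eq_of_integer x hx
    have hd : algebraMap B F d ≠ 0 := by
      rw [Ne, FaithfulSMul.algebraMap_eq_zero_iff]
      rintro h
      exact d.2 (by rw [h]; exact zero_mem _)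
    rw [(eq_mul_inv_iff_mul_eq₀ hd).2 had]
    exact V.mul_mem _ _ (hBV a) (hinv d d.2)
  rw [← HeightOneSpectrum.valuationSubringAtPrime_eq_valuationSubring] at hle
  -- The valuation ring at p lies in V and is maximal among proper subrings of F, so the two agree.
  have heq := (HeightOneSpectrum.valuationSubringAtPrime F p).eq_of_le_of_ne_top hle hV
  rw [HeightOneSpectrum.valuationSubringAtPrime_eq_valuationSubring] at heq
  rw [← heq]
  have : Nontrivial (MonoidWithZeroHom.valueGroup (.ofClass (p.valuation F))) := by
    obtain ⟨x, hx⟩ := p.valuation_exists_uniformizer F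
    rw [Subgroup.nontrivial_iff_exists_ne_one]
    refine ⟨Units.mk0 (p.valuation F x) (by simp [hx]),
      MonoidWithZeroHom.mem_valueGroup _ ⟨x, rfl⟩, fun h ↦ ?_⟩
    have h1 := congr(($h : WithZero (Multiplicative ℤ)))
    rw [Units.val_mk0, hx] at h1
    exact absurd h1 (by decide)
  infer_instance

-- V contains the principal ideal domain K[t], hence its integral closure in F. That closure is
-- Dedekind with fraction field F, because F is finite separable over K(t).
open scoped IntermediateField.algebraAdjoinAdjoin in
lemma isDiscreteValuationRing_of_mem {t : F}
    (hfin : FiniteDimensional K⟮t⟯ F) (hsep : Algebra.IsSeparable K⟮t⟯ F) (V : ValuationSubring F)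
    (hK : ∀ a : K, algebraMap K F a ∈ V) (htV : t ∈ V) (hV : V ≠ ⊤) :
    IsDiscreteValuationRing V := by
  let A := Algebra.adjoin K {t}
  have hPID : IsPrincipalIdealRing A := by
    have h := (Polynomial.aeval (R := K) t).rangeRestrict_surjective
    have := IsPrincipalIdealRing.of_surjective (Polynomial.aeval t).rangeRestrict.toRingHom h
    rwa [← Algebra.adjoin_singleton_eq_range_aeval] at this
  have hAV : ∀ a : A, (a : F) ∈ V := fun a ↦ by
    have : A ≤ ({ V.toSubring with algebraMap_mem' := hK } : Subalgebra K F) :=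
      Algebra.adjoin_le (by simpa using htV)
    exact this a.2
  let B := integralClosure A F
  have hDed : IsDedekindDomain B := integralClosure.isDedekindDomain A K⟮t⟯ F
  have hfrac : IsFractionRing B F :=
    IsIntegralClosure.isFractionRing_of_finite_extension A K⟮t⟯ F B
  refine isDiscreteValuationRing_of_isDedekindDomain (B := B) V (fun b ↦ ?_) hV
  obtain ⟨q, hq, hqb⟩ := b.2
  let ψ : A →+* V := (algebraMap A F).codRestrict V.toSubring hAV
  have hint : IsIntegral V (b : F) := by
    refine ⟨q.map ψ, hq.map _, ?_⟩
    rw [Polynomial.eval₂_map]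
    exact hqb
  obtain ⟨c, hc⟩ := IsIntegrallyClosed.isIntegral_iff.1 hint
  change algebraMap B F b ∈ V
  rw [show algebraMap B F b = (c : F) from hc.symm]
  exact c.2

/-- If `F` is finite and separable over `K(t)`, then the nontrivial valuation rings of `F / K` are
discrete. -/
lemma isDiscreteValuationRing_of_ne_top {t : F}
    (hfin : FiniteDimensional K⟮t⟯ F) (hsep : Algebra.IsSeparable K⟮t⟯ F) (V : ValuationSubring F)
    (hK : ∀ a : K, algebraMap K F a ∈ V) (hV : V ≠ ⊤) : IsDiscreteValuationRing V := by
  rcases V.mem_or_inv_mem t with ht | ht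
  · exact isDiscreteValuationRing_of_mem hfin hsep V hK ht hV
  · have heq : K⟮t⁻¹⟯ = K⟮t⟯ := by
      apply le_antisymm <;> rw [adjoin_simple_le_iff]
      · exact inv_mem (mem_adjoin_simple_self K t)
      · simpa using inv_mem (mem_adjoin_simple_self K t⁻¹)
    exact isDiscreteValuationRing_of_mem (t := t⁻¹) (heq ▸ hfin) (heq ▸ hsep) V hK ht hV

/-- If `F` is finite and separable over `K(t)`, then every element of `F` transcendental over `K`
has a zero. -/
lemma exists_place_mem_nonunits {t : F}
    (hfin : FiniteDimensional K⟮t⟯ F) (hsep : Algebra.IsSeparable K⟮t⟯ F) {z : F}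
    (hz : Transcendental K z) : ∃ v : Place K F, z ∈ v.ring.nonunits := by
  let A := Algebra.adjoin K {z}
  let z' : A.toSubring := ⟨z, Algebra.self_mem_adjoin_singleton K z⟩
  -- An inverse q(z) of z in K[z] would make z a root of Xq - 1.
  have hne : Ideal.span {z'} ≠ ⊤ := by
    rw [Ne, Ideal.span_singleton_eq_top]
    intro hu
    obtain ⟨c, hc⟩ := isUnit_iff_exists_inv.1 hu
    have hcA : (c : F) ∈ Algebra.adjoin K {z} := c.2
    rw [Algebra.adjoin_singleton_eq_range_aeval] at hcA
    obtain ⟨q, hq⟩ := hcA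
    have hzc : z * (c : F) = 1 := congr(($hc : F))
    refine hz ⟨Polynomial.X * q - 1, fun h0 ↦ ?_, ?_⟩
    · simpa using congr(Polynomial.eval 0 $h0)
    · simp only [map_sub, map_mul, Polynomial.aeval_X, map_one]
      rw [← hzc, ← hq, sub_eq_zero]
      rfl
  obtain ⟨V, hAV, hI⟩ := Ideal.image_subset_nonunits_valuationSubring _ hne
  have hzV : z ∈ V.nonunits := hI ⟨z', Ideal.mem_span_singleton_self _, rfl⟩
  have hK : ∀ a : K, algebraMap K F a ∈ V := fun a ↦ hAV (A.algebraMap_mem a)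
  refine ⟨⟨V, hK, isDiscreteValuationRing_of_ne_top hfin hsep V hK ?_⟩, hzV⟩
  rintro rfl
  rcases (ValuationSubring.mem_nonunits_iff_or _).1 hzV with rfl | h
  · exact hz isAlgebraic_zero
  · exact h (ValuationSubring.mem_top _)

end EDS

/-! ### Minimality of the constant equation -/

namespace EDS

open IsDedekindDomain

variable {K : Type u} [Field K] {F : Type u} [Field F] [Algebra K F]

namespace Place

variable (v : Place K F)

/-- The multiplicative valuation at a place. -/
noncomputable def val : Valuation F (WithZero (Multiplicative ℤ)) :=
  (IsDiscreteValuationRing.maximalIdeal v.ring).valuation F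

lemma ord_eq (x : F) : v.ord x = -WithZero.log (v.val x) := rfl

lemma val_le_one_iff (x : F) : v.val x ≤ 1 ↔ x ∈ v.ring := by
  refine ⟨fun h ↦ ?_, fun h ↦ ?_⟩
  · obtain ⟨a, rfl⟩ := IsDiscreteValuationRing.exists_lift_of_le_one h
    exact a.2
  · exact HeightOneSpectrum.valuation_le_one (IsDiscreteValuationRing.maximalIdeal v.ring) ⟨x, h⟩

lemma one_lt_val_iff (x : F) : 1 < v.val x ↔ x ∉ v.ring := by
  rw [← val_le_one_iff, not_le]

instance isTrivialOn : v.val.IsTrivialOn K where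
  eq_one a ha := by
    refine le_antisymm ((v.val_le_one_iff _).2 (v.algebraMap_mem a)) ?_
    have h := (v.val_le_one_iff _).2 (v.algebraMap_mem a⁻¹)
    rw [map_inv₀, map_inv₀] at h
    exact (inv_le_one₀ (by simpa [zero_lt_iff] using ha)).1 h

lemma ord_nonneg {x : F} (hx : x ∈ v.ring) : 0 ≤ v.ord x := by
  rw [ord_eq, Left.nonneg_neg_iff]
  by_cases h : v.val x = 0
  · simp [h]
  · rw [WithZero.log_le_iff_le_exp h]
    exact (v.val_le_one_iff x).2 hx

lemma ord_neg {x : F} (hx : x ∉ v.ring) : v.ord x < 0 := by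
  rw [ord_eq, Left.neg_neg_iff]
  rw [← one_lt_val_iff] at hx
  exact WithZero.lt_log_of_exp_lt hx

lemma ord_aeval {x : F} (hx : x ∉ v.ring) {f : Polynomial K} (hf : f ≠ 0) :
    v.ord (Polynomial.aeval x f) = f.natDegree * v.ord x := by
  rw [ord_eq, ord_eq,
    Polynomial.valuation_aeval_eq_valuation_X_pow_natDegree_of_one_lt_valuation_X _
      ((v.one_lt_val_iff x).2 hx) hf, WithZero.log_pow]
  simp

lemma aeval_mem {x : F} (hx : x ∈ v.ring) (f : Polynomial K) : Polynomial.aeval x f ∈ v.ring := by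
  let S : Subalgebra K F := { v.ring.toSubring with algebraMap_mem' := v.algebraMap_mem }
  exact S.aeval_coe (⟨x, hx⟩ : S) f ▸ (Polynomial.aeval (⟨x, hx⟩ : S) f).2

end Place

variable (E : WeierstrassCurve K) [E.IsElliptic] (v : Place K F)

/-- The constant equation is integral with unit discriminant, so the minimal discriminant is a unit
as well; the two differ by the factor u¹². -/
lemma val_toMinimal_u : v.val (toMinimal (E.toAffine.baseChange F) v).u = 1 := by
  set W : WeierstrassCurve F := E.toAffine.baseChange F
  have hmin := (W.exists_isMinimal v.ring).choose_spec
  change WeierstrassCurve.IsMinimal v.ring (toMinimal W v • W) at hmin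
  set c := toMinimal W v
  have hW : WeierstrassCurve.IsIntegral v.ring W :=
    ⟨E.map (algebraMap K F |>.codRestrict v.ring.toSubring v.algebraMap_mem), rfl⟩
  have hmax := hmin.val_Δ_maximal.2 (j := c⁻¹) (by simpa using hW)
  simp only [inv_smul_smul, one_smul] at hmax
  have hΔ : v.val W.Δ = 1 := by
    have : W.Δ = algebraMap K F E.Δ := E.map_Δ (algebraMap K F)
    rw [this]
    exact Valuation.IsTrivialOn.eq_one _ E.isUnit_Δ.ne_zero
  have h1 := WeierstrassCurve.valuation_Δ_aux_eq_of_isIntegral v.ring W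
  have h2 := WeierstrassCurve.valuation_Δ_aux_eq_of_isIntegral v.ring (c • W)
  have h3 := hmax (by
    rw [← Subtype.coe_le_coe, h1]
    exact (WeierstrassCurve.valuation_Δ_aux v.ring (c • W)).2.trans_eq hΔ.symm)
  rw [← Subtype.coe_le_coe, h1, h2] at h3
  have h4 : v.val (c • W).Δ = 1 := by
    refine le_antisymm ?_ (hΔ.symm.le.trans h3)
    rw [Place.val, ← h2]
    exact (WeierstrassCurve.valuation_Δ_aux v.ring (c • W)).2
  rw [WeierstrassCurve.variableChange_Δ, map_mul, hΔ, mul_one, map_pow] at h4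
  rw [pow_eq_one_iff_of_nonneg zero_le (by simp), Units.val_inv_eq_inv_val, map_inv₀,
    inv_eq_one] at h4
  exact h4

/-- If r were not integral, dividing the transformation rule of b₆ by r² and that of b₈ by r³ would
make 4r and 3r integral, hence also r = 4r - 3r. This works in every characteristic. -/
lemma toMinimal_r_mem : (toMinimal (E.toAffine.baseChange F) v).r ∈ v.ring := by
  have hu := val_toMinimal_u E v
  set W : WeierstrassCurve F := E.toAffine.baseChange F
  have hmin := (W.exists_isMinimal v.ring).choose_spec
  change WeierstrassCurve.IsMinimal v.ring (toMinimal W v • W) at hmin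
  set c := toMinimal W v
  have hu' : (c.u : F) ∈ v.ring := (v.val_le_one_iff _).1 hu.le
  by_contra hr
  have hs : c.r⁻¹ ∈ v.ring := (v.ring.mem_or_inv_mem c.r).resolve_left hr
  have hr0 : c.r ≠ 0 := fun h ↦ hr (h ▸ zero_mem _)
  have hb2 : W.b₂ ∈ v.ring := by
    rw [show W.b₂ = algebraMap K F E.b₂ from E.map_b₂ _]
    exact v.algebraMap_mem _
  have hb4 : W.b₄ ∈ v.ring := by
    rw [show W.b₄ = algebraMap K F E.b₄ from E.map_b₄ _]
    exact v.algebraMap_mem _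
  have hb6 : W.b₆ ∈ v.ring := by
    rw [show W.b₆ = algebraMap K F E.b₆ from E.map_b₆ _]
    exact v.algebraMap_mem _
  have hb8 : W.b₈ ∈ v.ring := by
    rw [show W.b₈ = algebraMap K F E.b₈ from E.map_b₈ _]
    exact v.algebraMap_mem _
  have hc6 : (c • W).b₆ ∈ v.ring := by
    rw [← WeierstrassCurve.integralModel_b₆_eq v.ring (c • W)]
    exact Subtype.prop _
  have hc8 : (c • W).b₈ ∈ v.ring := by
    rw [← WeierstrassCurve.integralModel_b₈_eq v.ring (c • W)]
    exact Subtype.prop _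
  have e6 := WeierstrassCurve.variableChange_b₆ W c
  have e8 := WeierstrassCurve.variableChange_b₈ W c
  have hu0 : (c.u : F) ≠ 0 := c.u.ne_zero
  rw [Units.val_inv_eq_inv_val] at e6 e8
  refine hr ?_
  have key : c.r = ((c • W).b₆ * c.u ^ 6 * c.r⁻¹ ^ 2 - W.b₆ * c.r⁻¹ ^ 2 - (W.b₄ + W.b₄) * c.r⁻¹
      - W.b₂) - ((c • W).b₈ * c.u ^ 8 * c.r⁻¹ ^ 3 - W.b₈ * c.r⁻¹ ^ 3 -
        (W.b₆ + W.b₆ + W.b₆) * c.r⁻¹ ^ 2 - (W.b₄ + W.b₄ + W.b₄) * c.r⁻¹ - W.b₂) := by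
    rw [e6, e8]
    field_simp
    ring
  rw [key]
  have hadd {a b} := v.ring.add_mem a b
  have hmul {a b} := v.ring.mul_mem a b
  have hsub {a b : F} : a ∈ v.ring → b ∈ v.ring → a - b ∈ v.ring := sub_mem
  have hpow {a : F} (n : ℕ) : a ∈ v.ring → a ^ n ∈ v.ring := fun h ↦ pow_mem h n
  refine hsub (hsub (hsub (hsub ?_ ?_) ?_) hb2) (hsub (hsub (hsub (hsub ?_ ?_) ?_) ?_) hb2)
  · exact hmul (hmul hc6 (hpow _ hu')) (hpow _ hs)
  · exact hmul hb6 (hpow _ hs)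
  · exact hmul (hadd hb4 hb4) hs
  · exact hmul (hmul hc8 (hpow _ hu')) (hpow _ hs)
  · exact hmul hb8 (hpow _ hs)
  · exact hmul (hadd (hadd hb6 hb6) hb6) (hpow _ hs)
  · exact hmul (hadd (hadd hb4 hb4) hb4) hs

/-- The constant Weierstrass equation is minimal at every place, so the denominator of a point can
be computed on it. -/
lemma denominator_some {x y : F} (h : (E.toAffine.baseChange F).Nonsingular x y) :
    denominator (E.toAffine.baseChange F) (.some x y h) v = max (-(1 / 2) * (v.ord x : ℚ)) 0 := by
  have hu := val_toMinimal_u E v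
  have hr := toMinimal_r_mem E v
  have hval : v.val (minimalX (E.toAffine.baseChange F) v x) =
      v.val (x - (toMinimal (E.toAffine.baseChange F) v).r) := by
    rw [minimalX, map_div₀, map_pow, hu, one_pow, div_one]
  change max (-(1 / 2) * (v.ord (minimalX (E.toAffine.baseChange F) v x) : ℚ)) 0 = _
  by_cases hx : x ∈ v.ring
  · have h1 : minimalX (E.toAffine.baseChange F) v x ∈ v.ring := by
      rw [← v.val_le_one_iff, hval, v.val_le_one_iff]
      exact sub_mem hx hr
    have h2 : (0 : ℚ) ≤ v.ord x := by exact_mod_cast v.ord_nonneg hx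
    have h3 : (0 : ℚ) ≤ v.ord (minimalX (E.toAffine.baseChange F) v x) := by
      exact_mod_cast v.ord_nonneg h1
    rw [max_eq_right (by linarith), max_eq_right (by linarith)]
  · have : v.ord (minimalX (E.toAffine.baseChange F) v x) = v.ord x := by
      rw [v.ord_eq, v.ord_eq, hval, Valuation.map_sub_eq_of_lt_left]
      exact ((v.val_le_one_iff _).2 hr).trans_lt ((v.one_lt_val_iff _).2 hx)
    rw [this]

lemma denominator_pos_iff {x y : F} (h : (E.toAffine.baseChange F).Nonsingular x y) :
    0 < denominator (E.toAffine.baseChange F) (.some x y h) v ↔ x ∉ v.ring := by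
  rw [denominator_some, lt_max_iff, or_iff_left (lt_irrefl _)]
  refine ⟨fun h hx ↦ ?_, fun hx ↦ ?_⟩
  · have h2 : (0 : ℚ) ≤ v.ord x := by exact_mod_cast v.ord_nonneg hx
    linarith
  · have h2 : (v.ord x : ℚ) < 0 := by exact_mod_cast v.ord_neg hx
    linarith

end EDS

/-! ### Primitive valuations from torsion points -/

namespace EDS

open Polynomial

variable {K : Type u} [Field K] {F : Type u} [Field F] [Algebra K F]

namespace Place

variable (v : Place K F)

lemma val_lt_one_iff (x : F) : v.val x < 1 ↔ x ∈ v.ring.nonunits := by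
  rw [ValuationSubring.mem_nonunits_iff_or]
  by_cases hx : x = 0
  · simp [hx]
  · rw [or_iff_right hx, ← one_lt_val_iff, map_inv₀, one_lt_inv₀ (by simpa [zero_lt_iff] using hx)]

variable {x : F} {m f g : K[X]}

lemma mem_ring_of_val_aeval_lt_one (hm : m ≠ 0) (hv : v.val (aeval x m) < 1) : x ∈ v.ring := by
  by_contra hx
  rw [valuation_aeval_eq_valuation_X_pow_natDegree_of_one_lt_valuation_X _
      ((v.one_lt_val_iff x).2 hx) hm] at hv
  exact hv.not_ge (one_le_pow₀ ((v.one_lt_val_iff x).2 hx).le)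

lemma val_aeval_le_one (hx : x ∈ v.ring) (f : K[X]) : v.val (aeval x f) ≤ 1 :=
  (v.val_le_one_iff _).2 (v.aeval_mem hx f)

lemma val_aeval_eq_one_of_isCoprime (hx : x ∈ v.ring) (hfg : IsCoprime f g)
    (hf : v.val (aeval x f) < 1) : v.val (aeval x g) = 1 := by
  refine (v.val_aeval_le_one hx g).antisymm (not_lt.1 fun hg ↦ ?_)
  obtain ⟨a, b, hab⟩ := hfg
  have h := congr(v.val (aeval x $hab))
  rw [map_add, map_mul, map_mul, map_one, map_one] at h
  refine (Valuation.map_add_lt _ ?_ ?_).ne h <;> rw [map_mul]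
  · exact mul_lt_one_of_nonneg_of_lt_one_right (v.val_aeval_le_one hx a) zero_le hf
  · exact mul_lt_one_of_nonneg_of_lt_one_right (v.val_aeval_le_one hx b) zero_le hg

/-- The residue of x is a root of the irreducible m, so m generates the kernel of evaluation into
the residue field. -/
lemma val_aeval_lt_one_iff_dvd (hm : Irreducible m) (hv : v.val (aeval x m) < 1) :
    v.val (aeval x f) < 1 ↔ m ∣ f := by
  have hx := v.mem_ring_of_val_aeval_lt_one hm.ne_zero hv
  refine ⟨fun hf ↦ ?_, ?_⟩
  · by_contra hd
    exact hf.ne (v.val_aeval_eq_one_of_isCoprime hx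
      ((hm.isCoprime_or_dvd f).resolve_right hd) hv)
  · rintro ⟨g, rfl⟩
    rw [map_mul, map_mul]
    exact mul_lt_one_of_nonneg_of_lt_one_left zero_le hv (v.val_aeval_le_one hx g)

end Place

variable {E : WeierstrassCurve K} [E.IsElliptic] (v : Place K F) [DecidableEq F]

/-- At a place where `P` is integral, the denominator of `n P` is positive where `P` reduces to a
root of the denominator of multiplication by `n`. -/
lemma eds_some_pos_iff {x y : F} {h : (E.toAffine.baseChange F).Nonsingular x y} {n : ℕ}
    {A B : K[X]} (hn : E.IsMulPair n A B) (hx : x ∈ v.ring)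
    (h0 : n • WeierstrassCurve.Affine.Point.some x y h ≠ 0) :
    0 < eds K (E.toAffine.baseChange F) (.some x y h) n v ↔ v.val (aeval x B) < 1 := by
  rw [eds]
  rcases hP : n • WeierstrassCurve.Affine.Point.some x y h with _ | ⟨x', y', h'⟩
  · exact absurd hP h0
  obtain ⟨hB, hAB⟩ := hn.aeval_eq_of_smul_eq_some h hP
  rw [denominator_pos_iff, ← v.one_lt_val_iff, eq_div_of_mul_eq hB hAB, map_div₀]
  refine ⟨fun h1 ↦ ?_, fun h1 ↦ ?_⟩
  · refine (v.val_aeval_le_one hx B).lt_of_ne fun h2 ↦ ?_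
    rw [h2, div_one] at h1
    exact h1.not_ge (v.val_aeval_le_one hx A)
  -- Where B vanishes the coprime A is a unit, so no cancellation hides the pole.
  · rw [v.val_aeval_eq_one_of_isCoprime hx hn.isCoprime.symm h1, one_div]
    exact (one_lt_inv₀ (by simpa [zero_lt_iff] using hB)).2 h1

/-- Multiplication by a polynomial map multiplies the denominator by its degree. -/
lemma denominator_smul_eq {p : ℕ} {A : K[X]} {c : K} (hc : c ≠ 0) (hp : E.IsMulPair p A (C c))
    (R : (E.toAffine.baseChange F).Point) (h0 : p • R ≠ 0) :
    denominator (E.toAffine.baseChange F) (p • R) v =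
      (p : ℚ) ^ 2 * denominator (E.toAffine.baseChange F) R v := by
  rcases R with _ | ⟨x, y, h⟩
  · exact absurd (smul_zero p) h0
  rcases hP : p • WeierstrassCurve.Affine.Point.some x y h with _ | ⟨x', y', h'⟩
  · exact absurd hP h0
  have hx' : x' = aeval x (C c⁻¹ * A) := by
    obtain ⟨hB, hAB⟩ := hp.aeval_eq_of_smul_eq_some h hP
    rw [eq_div_of_mul_eq hB hAB, map_mul, aeval_C, aeval_C, map_inv₀, div_eq_inv_mul]
  have hdeg : (C c⁻¹ * A).natDegree = p ^ 2 := by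
    rw [natDegree_C_mul (inv_ne_zero hc), hp.natDegree_left]
  rw [denominator_some, denominator_some]
  by_cases hx : x ∈ v.ring
  · have h1 : (0 : ℚ) ≤ v.ord x := by exact_mod_cast v.ord_nonneg hx
    have h2 : (0 : ℚ) ≤ v.ord x' := by
      rw [hx']
      exact_mod_cast v.ord_nonneg (v.aeval_mem hx _)
    rw [max_eq_right (by linarith), max_eq_right (by linarith), mul_zero]
  · rw [hx', v.ord_aeval hx (mul_ne_zero (C_ne_zero.2 (inv_ne_zero hc)) hp.monic.ne_zero), hdeg]
    rw [mul_max_of_nonneg _ _ (by positivity), mul_zero]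
    congr 1
    push_cast
    ring

omit [E.IsElliptic] in
/-- A nonconstant point has a transcendental `x`-coordinate. -/
lemma transcendental_of_notMem_range [DecidableEq K]
    (halg : ∀ z : F, IsAlgebraic K z → z ∈ (algebraMap K F).range)
    {x y : F} {h : (E.toAffine.baseChange F).Nonsingular x y}
    (hP : WeierstrassCurve.Affine.Point.some x y h ∉
      Set.range (WeierstrassCurve.Affine.Point.baseChange (W' := E.toAffine) K F)) :
    Transcendental K x := by
  intro hx
  obtain ⟨a, rfl⟩ := halg x hx
  have hy : IsIntegral K y := by
    refine ⟨X ^ 2 + C (E.a₁ * a + E.a₃) * X - C (a ^ 3 + E.a₂ * a ^ 2 + E.a₄ * a + E.a₆), ?_, ?_⟩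
    · monicity!
    · have heq := (WeierstrassCurve.Affine.equation_iff ..).1 h.1
      simp [WeierstrassCurve.Affine.baseChange] at heq ⊢
      linear_combination heq
  obtain ⟨b, rfl⟩ := halg y hy.isAlgebraic
  exact hP ⟨.some a b ((E.toAffine.baseChange_nonsingular
    (Algebra.ofId K F).injective a b).1 h), rfl⟩

/-- The terms of an elliptic divisibility sequence have primitive valuations if the curve has
points of the corresponding orders. -/
lemma hasPrimitiveValuation_of_addOrderOf_eq {t : F}
    (hfin : FiniteDimensional (IntermediateField.adjoin K {t}) F)
    (hsep : Algebra.IsSeparable (IntermediateField.adjoin K {t}) F)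
    {x y : F} {h : (E.toAffine.baseChange F).Nonsingular x y} (hx : Transcendental K x)
    (hinf : ¬ IsOfFinAddOrder (WeierstrassCurve.Affine.Point.some x y h)) {n : ℕ} (hn : 0 < n)
    {L : Type u} [Field L] [DecidableEq L] [Algebra K L] [Algebra.IsAlgebraic K L]
    (T : (E.toAffine.baseChange L).Point)
    (hT : addOrderOf T = n) :
    HasPrimitiveValuation (eds K (E.toAffine.baseChange F) (.some x y h)) n := by
  have hne : ∀ k : ℕ, 0 < k → k • WeierstrassCurve.Affine.Point.some x y h ≠ 0 := fun k hk h0 ↦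
    hinf (isOfFinAddOrder_iff_nsmul_eq_zero.2 ⟨k, hk, h0⟩)
  rcases T with _ | ⟨a, b, hab⟩
  · rw [← WeierstrassCurve.Affine.Point.zero_def, addOrderOf_zero] at hT
    subst hT
    -- T = O means n = 1: any pole of x works, there being no smaller index.
    obtain ⟨v, hv⟩ := exists_place_mem_nonunits hfin hsep
      (show Transcendental K x⁻¹ from fun h ↦ hx (IsAlgebraic.inv_iff.1 h))
    refine ⟨v, ?_, by lia⟩
    rw [eds, one_smul, denominator_pos_iff]
    rcases v.ring.inv_mem_nonunits_iff.1 hv with rfl | h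
    · exact absurd isAlgebraic_zero hx
    · exact h
  · have ha : IsIntegral K a := Algebra.IsIntegral.isIntegral a
    have hm := minpoly.irreducible ha
    have htr : Transcendental K (aeval x (minpoly K a)) := by
      exact hx.aeval _ (minpoly.natDegree_pos ha).ne' (by
        rw [(minpoly.monic ha).leadingCoeff]
        exact one_mem _)
    obtain ⟨v, hv⟩ := exists_place_mem_nonunits hfin hsep htr
    rw [← v.val_lt_one_iff] at hv
    -- At v the point P behaves like T: the minimal polynomial of a divides the denominator of
    -- multiplication by k iff kT = O.
    have key : ∀ k, 0 < k → (0 < eds K (E.toAffine.baseChange F) (.some x y h) k v ↔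
        k • WeierstrassCurve.Affine.Point.some a b hab = 0) := fun k hk ↦ by
      obtain ⟨A, B, hAB⟩ := E.exists_isMulPair k
      rw [eds_some_pos_iff v hAB (v.mem_ring_of_val_aeval_lt_one hm.ne_zero hv) (hne k hk),
        v.val_aeval_lt_one_iff_dvd hm hv, hAB.smul_eq_zero_iff, minpoly.dvd_iff]
    refine ⟨v, (key n hn).2 (hT ▸ addOrderOf_nsmul_eq_zero _), fun m hm hmn hpos ↦ ?_⟩
    exact (addOrderOf_le_of_nsmul_eq_zero hm ((key m hm).1 hpos)).not_gt (hT ▸ hmn)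


lemma exists_isMulPair_C_of_isSupersingular (hE : IsSupersingular E) (p : ℕ) [CharP K p] :
    p.Prime ∧ ∃ A : K[X], ∃ c : K, c ≠ 0 ∧ E.IsMulPair p A (C c) := by
  classical
  rw [IsSupersingular, ringChar.eq K p] at hE
  have hp : p.Prime := (CharP.char_is_prime_or_zero K p).resolve_right hE.1.ne'
  obtain ⟨A, B, h⟩ := E.exists_isMulPair p
  obtain ⟨c, hc, rfl⟩ := h.eq_C_of_torsion_eq_zero E (AlgebraicClosure K) fun R hR ↦
    hE.2 R (by convert! hR)
  exact ⟨hp, A, c, hc, h⟩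

/-- Existence and non-existence of primitive valuations over a field `F` that is finite separable
over a rational function field over `K`, and in which `K` is algebraically closed. -/
theorem primitiveValuation_of_isSeparable [DecidableEq K] (p : ℕ) [CharP K p] {t : F}
    (hfin : FiniteDimensional (IntermediateField.adjoin K {t}) F)
    (hsep : Algebra.IsSeparable (IntermediateField.adjoin K {t}) F)
    (halg : ∀ z : F, IsAlgebraic K z → z ∈ (algebraMap K F).range)
    (P : (E.toAffine.baseChange F).Point)
    (hP : P ∉ Set.range (WeierstrassCurve.Affine.Point.baseChange (W' := E.toAffine) K F))
    (hinf : ¬ IsOfFinAddOrder P) (n : ℕ) (hn : 0 < n) :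
    ((¬ p ∣ n ∨ IsOrdinary E) → HasPrimitiveValuation (eds K (E.toAffine.baseChange F) P) n) ∧
      (p ∣ n → IsSupersingular E →
        (∀ v : Place K F, eds K (E.toAffine.baseChange F) P n v =
          (p : ℚ) ^ 2 * eds K (E.toAffine.baseChange F) P (n / p) v) ∧
        ¬ HasPrimitiveValuation (eds K (E.toAffine.baseChange F) P) n) := by
  classical
  have hne : ∀ k : ℕ, 0 < k → k • P ≠ 0 := fun k hk h0 ↦
    hinf (isOfFinAddOrder_iff_nsmul_eq_zero.2 ⟨k, hk, h0⟩)
  constructor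
  · intro hord
    obtain ⟨T, hT⟩ := E.exists_addOrderOf_eq (AlgebraicClosure K) p hn fun hp hpn ↦ by
      have hE := hord.resolve_left (not_not.2 hpn)
      simp only [IsOrdinary, IsSupersingular, ringChar.eq K p, not_and, not_forall] at hE
      obtain ⟨R, hR, hR0⟩ := hE hp.pos
      exact ⟨R, hR0, by convert! hR⟩
    rcases P with _ | ⟨x, y, h⟩
    · exact absurd (smul_zero 1) (hne 1 one_pos)
    exact hasPrimitiveValuation_of_addOrderOf_eq hfin hsep
      (transcendental_of_notMem_range halg hP) hinf hn T hT
  · intro hpn hE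
    obtain ⟨hp, A, c, hc, hA⟩ := exists_isMulPair_C_of_isSupersingular hE p
    have key : ∀ v : Place K F, eds K (E.toAffine.baseChange F) P n v =
        (p : ℚ) ^ 2 * eds K (E.toAffine.baseChange F) P (n / p) v := fun v ↦ by
      have hnp : p • (n / p) • P = n • P := by rw [smul_smul, Nat.mul_div_cancel' hpn]
      rw [eds, ← hnp, denominator_smul_eq v hc hA _ (hnp ▸ hne n hn), eds]
    -- Every place in the support of D_n already occurs at the smaller index n / p.
    refine ⟨key, fun ⟨v, hv, hprim⟩ ↦ hprim (n / p)
      (Nat.div_pos (Nat.le_of_dvd hn hpn) hp.pos) (Nat.div_lt_self hn hp.one_lt) ?_⟩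
    rw [key v] at hv
    exact pos_of_mul_pos_right hv (by positivity)

end EDS

/-! ### Separable generation and the field of constants: algebra -/

namespace EDS

open Polynomial IntermediateField TensorProduct

variable {K : Type u} [Field K] {F : Type u} [Field F] [Algebra K F]

open scoped IntermediateField.algebraAdjoinAdjoin in
/-- Separability descends along a purely transcendental extension. -/
lemma isSeparable_of_isSeparable_adjoin {t α : F} (ht : Transcendental K t) (hα : IsIntegral K α)
    (hsep : IsSeparable K⟮t⟯ α) : IsSeparable K α := by
  let A := Algebra.adjoin K {t}
  let e : K[X] ≃ₐ[K] A := (AlgEquiv.ofInjective (aeval t)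
    (transcendental_iff_injective.1 ht)).trans
      (Subalgebra.equivOfEq _ _ (Algebra.adjoin_singleton_eq_range_aeval K t).symm)
  have hPID : IsPrincipalIdealRing A :=
    IsPrincipalIdealRing.of_surjective e.toRingEquiv.toRingHom e.surjective
  -- Specializing t to 0 sends q, a divisor of m over K[t], to a nonconstant divisor of the
  -- irreducible m. Degrees then force q = m, so α has the same minimal polynomial over K and K(t).
  let σ : A →ₐ[K] K := (aeval 0).comp e.symm.toAlgHom
  have hαA : IsIntegral A α := hα.tower_top
  set m := minpoly K α
  set q := minpoly A α
  have hqm : q ∣ m.map (algebraMap K A) := by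
    refine minpoly.isIntegrallyClosed_dvd hαA ?_
    rw [aeval_map_algebraMap]
    exact minpoly.aeval K α
  have hq : q.Monic := minpoly.monic hαA
  have hm : m.Monic := minpoly.monic hα
  have hσ : q.map σ.toRingHom = m := by
    have hd : q.map σ.toRingHom ∣ m := by
      have := Polynomial.map_dvd σ.toRingHom hqm
      rw [Polynomial.map_map] at this
      convert! this
      rw [show σ.toRingHom.comp (algebraMap K A) = RingHom.id K from σ.comp_algebraMap,
        Polynomial.map_id]
    refine eq_of_monic_of_associated (hq.map _) hm
      (((minpoly.irreducible hα).dvd_iff.1 hd).resolve_left fun hu ↦ ?_).symm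
    have := (hq.map σ.toRingHom).eq_one_of_isUnit hu
    have h2 := congr(natDegree $this)
    rw [hq.natDegree_map, natDegree_one] at h2
    exact (minpoly.natDegree_pos hαA).ne' h2
  have hqm' : m.map (algebraMap K A) = q := by
    refine eq_of_monic_of_dvd_of_natDegree_le hq (hm.map _) hqm ?_
    rw [hm.natDegree_map, ← hσ, hq.natDegree_map]
  have hmin := minpoly.isIntegrallyClosed_eq_field_fractions K⟮t⟯ F hαA
  rw [Algebra.algebraMap_self_apply] at hmin
  rw [IsSeparable, hmin, show minpoly A α = m.map (algebraMap K A) from hqm'.symm,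
    Polynomial.map_map, separable_map] at hsep
  exact hsep

/-- The fraction field of a domain that is étale over `K[X]` is finite and separable over a
rational function field. -/
lemma exists_finite_separable_of_etale {A : Type u} [CommRing A] [IsDomain A] [Algebra K A]
    [Algebra A F] [IsScalarTower K A F] [IsFractionRing A F]
    (g : MvPolynomial (Fin 1) K →ₐ[K] A) (hg : g.toRingHom.Etale) :
    ∃ t : F, Transcendental K t ∧ FiniteDimensional K⟮t⟯ F ∧ Algebra.IsSeparable K⟮t⟯ F := by
  let R := MvPolynomial (Fin 1) K
  algebraize [g.toRingHom]
  have hEt : Algebra.Etale R A := hg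
  let : Algebra R F := ((algebraMap A F).comp g.toRingHom).toAlgebra
  have : IsScalarTower R A F := .of_algebraMap_eq fun _ ↦ rfl
  -- Étale implies flat, so a nonzero polynomial acts injectively on A and cannot map to 0.
  have hinj : Function.Injective g := by
    refine (injective_iff_map_eq_zero g).2 fun r hr ↦ by_contra fun h0 ↦ one_ne_zero (α := A) ?_
    refine (Module.Flat.isSMulRegular_of_nonZeroDivisors (M := A)
      (mem_nonZeroDivisors_of_ne_zero h0)) ?_
    simp only [Algebra.smul_def, mul_one, mul_zero]
    exact hr
  let t : F := algebraMap A F (g (MvPolynomial.X 0))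
  have ht : Transcendental K t :=
    (transcendental_algebraMap_iff (IsFractionRing.injective A F)).2
      (mt (isAlgebraic_algHom_iff g hinj).1 (MvPolynomial.transcendental_X K 0))
  have hmem : ∀ r : R, algebraMap R F r ∈ K⟮t⟯ := fun r ↦ by
    have hr : algebraMap R F r = MvPolynomial.aeval (fun _ ↦ t) r := by
      change ((IsScalarTower.toAlgHom K A F).comp g) r = _
      congr 1
      ext i
      simp [t, Subsingleton.elim i 0]
    rw [hr]
    clear hr
    induction r using MvPolynomial.induction_on with
    | C a => simp
    | add a b ha hb => rw [map_add]; exact add_mem ha hb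
    | mul_X a i ha => simpa using mul_mem ha (mem_adjoin_simple_self K t)
  let : Algebra R K⟮t⟯ := ((algebraMap R F).codRestrict K⟮t⟯.toSubring hmem).toAlgebra
  have : IsScalarTower R K⟮t⟯ F := .of_algebraMap_eq fun _ ↦ rfl
  have : Algebra.FormallyEtale A F := .of_isLocalization (nonZeroDivisors A)
  have : Algebra.FormallyUnramified R F := .comp R A F
  have : Algebra.FormallyUnramified K⟮t⟯ F := .of_restrictScalars R K⟮t⟯ F
  have : Algebra.EssFiniteType A F := .of_isLocalization _ (nonZeroDivisors A)
  have : Algebra.EssFiniteType R F := .comp R A F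
  have : Algebra.EssFiniteType K⟮t⟯ F := .of_comp R K⟮t⟯ F
  exact ⟨t, ht, Algebra.FormallyUnramified.finite_of_free K⟮t⟯ F,
    Algebra.FormallyUnramified.isSeparable K⟮t⟯ F⟩

/-- If `Spec (L ⊗ A)` is irreducible, with `L` algebraically closed, then elements of `A` that are
separable over `K` lie in `K`. -/
lemma mem_range_of_irreducibleSpace {A : Type u} [CommRing A] [IsDomain A] [Algebra K A]
    (L : Type u) [Field L] [Algebra K L] [IsAlgClosed L]
    [IrreducibleSpace (PrimeSpectrum (L ⊗[K] A))] {α : A} (hα : IsIntegral K α)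
    (hsep : (minpoly K α).Separable) : α ∈ (algebraMap K A).range := by
  set m := minpoly K α
  have hm : Irreducible m := minpoly.irreducible hα
  have hprime : (nilradical (L ⊗[K] A)).IsPrime :=
    PrimeSpectrum.irreducibleSpace_iff_isPrime_nilradical.1 inferInstance
  have hsplit : (m.map (algebraMap K L)).Splits := IsAlgClosed.splits _
  have hm0 : m.Monic := minpoly.monic hα
  -- Over L the equation m(1 ⊗ α) = 0 splits into linear factors; the nilradical is prime, so one
  -- factor is nilpotent.
  have hprod : ((m.map (algebraMap K L)).roots.map
      fun β ↦ (1 : L) ⊗ₜ[K] α - β ⊗ₜ[K] (1 : A)).prod = 0 := by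
    have h1 := congr((aeval ((1 : L) ⊗ₜ[K] α) : L[X] →ₐ[L] _)
      $(hsplit.eq_prod_roots_of_monic (hm0.map _)))
    rw [aeval_map_algebraMap, map_multiset_prod, Multiset.map_map] at h1
    rw [show (fun β ↦ (1 : L) ⊗ₜ[K] α - β ⊗ₜ[K] (1 : A)) =
      (fun β ↦ (aeval ((1 : L) ⊗ₜ[K] α) : L[X] →ₐ[L] L ⊗[K] A) (X - C β)) from ?_]
    · refine Eq.trans h1.symm ?_
      have := aeval_algHom_apply (Algebra.TensorProduct.includeRight : A →ₐ[K] L ⊗[K] A) α m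
      rw [minpoly.aeval, map_zero] at this
      exact this
    · ext β
      simp [Algebra.TensorProduct.algebraMap_apply]
  obtain ⟨β, hβ, hβn⟩ : ∃ β ∈ (m.map (algebraMap K L)).roots,
      (1 : L) ⊗ₜ[K] α - β ⊗ₜ[K] (1 : A) ∈ nilradical (L ⊗[K] A) := by
    have := hprime.multiset_prod_mem_iff_exists_mem (s := (m.map (algebraMap K L)).roots.map
      fun β ↦ (1 : L) ⊗ₜ[K] α - β ⊗ₜ[K] (1 : A)) |>.1 (hprod ▸ zero_mem _)
    simpa using this
  have : Fact (Irreducible m) := ⟨hm⟩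
  let j : AdjoinRoot m →ₐ[K] A := AdjoinRoot.liftAlgHom m (Algebra.ofId K A) α (minpoly.aeval K α)
  have hj : Function.Injective (Algebra.TensorProduct.map (AlgHom.id K L) j) :=
    Module.Flat.lTensor_preserves_injective_linearMap (M := L) j.toLinearMap
      j.toRingHom.injective
  have hnil : IsNilpotent ((1 : L) ⊗ₜ[K] AdjoinRoot.root m - β ⊗ₜ[K] (1 : AdjoinRoot m)) := by
    rw [← IsNilpotent.map_iff hj]
    have h2 : j (AdjoinRoot.root m) = α := AdjoinRoot.liftAlgHom_root ..
    simpa [h2] using mem_nilradical.1 hβn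
  -- A root γ gives a map from L ⊗ K[X]/(m) to the field L sending the nilpotent element to γ - β,
  -- so γ = β. Separability then makes m linear.
  have hroot : ∀ γ ∈ (m.map (algebraMap K L)).roots, γ = β := fun γ hγ ↦ by
    have hγ' : aeval γ m = 0 := by
      rw [aeval_def, ← Polynomial.eval_map]
      exact (mem_roots'.1 hγ).2
    let s : AdjoinRoot m →ₐ[K] L := AdjoinRoot.liftAlgHom m (Algebra.ofId K L) γ hγ'
    have h3 := hnil.map (Algebra.TensorProduct.lift (AlgHom.id K L) s fun _ _ ↦ .all _ _)
    have h2 : s (AdjoinRoot.root m) = γ := AdjoinRoot.liftAlgHom_root ..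
    simpa [h2, sub_eq_zero] using h3.eq_zero
  have hcard : (m.map (algebraMap K L)).roots.card ≤ 1 := by
    have hnd : (m.map (algebraMap K L)).roots.Nodup := nodup_roots hsep.map
    classical
    refine (Multiset.toFinset_card_of_nodup hnd).symm.trans_le (Finset.card_le_one.2 ?_)
    intro a ha b hb
    rw [hroot a (Multiset.mem_toFinset.1 ha), hroot b (Multiset.mem_toFinset.1 hb)]
  rw [← hsplit.natDegree_eq_card_roots, natDegree_map] at hcard
  exact minpoly.natDegree_eq_one_iff.1 (hcard.antisymm (minpoly.natDegree_pos hα))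

end EDS

/-! ### Separable generation and the field of constants: geometry -/

namespace EDS

open IntermediateField TensorProduct

variable {K : Type u} [Field K] {C : Scheme.{u}} (π : C ⟶ Spec (.of K))

/-- The structure map of the `K`-algebra of sections of a `K`-scheme over an open subset. -/
noncomputable def sectionConstants (V : C.Opens) : K →+* Γ(C, V) :=
  ((Scheme.ΓSpecIso (.of K)).inv ≫ π.appLE ⊤ V le_top).hom

lemma germ_sectionConstants [IsIntegral C] (V : C.Opens) [Nonempty V] (a : K) :
    C.germToFunctionField V (sectionConstants π V a) = constants π a := by
  have h : (Scheme.ΓSpecIso (.of K)).inv ≫ π.appLE ⊤ V le_top ≫ C.germToFunctionField V =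
      (Scheme.ΓSpecIso (.of K)).inv ≫ π.appTop ≫ C.presheaf.germ ⊤ (genericPoint C) trivial := by
    have h1 : π.appLE ⊤ V le_top = π.appTop ≫ C.presheaf.map (homOfLE le_top).op := rfl
    rw [h1, Category.assoc, Scheme.germToFunctionField, C.presheaf.germ_res]
  exact congr($(h).hom a)

variable {F : Type u} [Field F] [Algebra K F]

/-- The restriction map from sections to a field identified with the function field. -/
noncomputable def sectionToField [IsIntegral C] (e : F ≃+* C.functionField) (V : C.Opens)
    [Nonempty V] : Γ(C, V) →+* F :=
  e.symm.toRingHom.comp (C.germToFunctionField V).hom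

lemma sectionToField_comp [IsIntegral C] {e : F ≃+* C.functionField}
    (he : ∀ a : K, e (algebraMap K F a) = constants π a) (V : C.Opens) [Nonempty V] :
    (sectionToField e V).comp (sectionConstants π V) = algebraMap K F := by
  ext a
  exact e.symm_apply_eq.2 ((germ_sectionConstants π V a).trans (he a).symm)

lemma isFractionRing_sectionToField [IsIntegral C] (e : F ≃+* C.functionField) {V : C.Opens}
    [Nonempty V] (hV : IsAffineOpen V) :
    let := (sectionToField e V).toAlgebra
    IsFractionRing Γ(C, V) F := by
  let := (sectionToField e V).toAlgebra
  have := functionField_isFractionRing_of_isAffineOpen C V hV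
  let e' : C.functionField ≃ₐ[Γ(C, V)] F := { e.symm with commutes' := fun _ ↦ rfl }
  exact IsLocalization.isLocalization_of_algEquiv _ e'

variable {π}

/-- The function field of a smooth curve over `K` is finite separable over a rational function
field. -/
lemma IsFunctionFieldOf.exists_finite_separable [IsIntegral C] [SmoothOfRelativeDimension 1 π]
    (hF : IsFunctionFieldOf π F) :
    ∃ t : F, Transcendental K t ∧ FiniteDimensional K⟮t⟯ F ∧ Algebra.IsSeparable K⟮t⟯ F := by
  obtain ⟨e, he⟩ := hF
  obtain ⟨U, hU, V, hV, hx, hUV, hf⟩ :=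
    SmoothOfRelativeDimension.exists_isStandardSmoothOfRelativeDimension (n := 1) (f := π)
      (genericPoint C)
  have hV0 : Nonempty V := ⟨⟨_, hx⟩⟩
  -- The spectrum of K has a single point.
  obtain rfl : U = ⊤ := by
    ext x
    have : Subsingleton (Spec (.of K)) := inferInstanceAs (Subsingleton (PrimeSpectrum K))
    simpa [Subsingleton.elim x (π (genericPoint C))] using hUV hx
  have hs : (sectionConstants π V).IsStandardSmoothOfRelativeDimension 1 :=
    RingHom.isStandardSmoothOfRelativeDimension_respectsIso.2 _
      (Scheme.ΓSpecIso (.of K)).symm.commRingCatIsoToRingEquiv hf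
  obtain ⟨g, hgC, hg⟩ := hs.exists_etale_mvPolynomial
  let := (sectionConstants π V).toAlgebra
  let := (sectionToField e V).toAlgebra
  have : IsScalarTower K Γ(C, V) F := .of_algebraMap_eq' (sectionToField_comp π he V).symm
  have := isFractionRing_sectionToField e hV
  exact exists_finite_separable_of_etale
    ({ g with commutes' := fun a ↦ congr($hgC a) } : MvPolynomial (Fin 1) K →ₐ[K] Γ(C, V)) hg

-- Geometric irreducibility passes to a nonempty affine open V, whose base change to L is the
-- spectrum of L ⊗ Γ(C, V).
variable (π) in
lemma irreducibleSpace_tensorProduct [GeometricallyIrreducible π] {V : C.Opens} [Nonempty V]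
    (hV : IsAffineOpen V) (L : Type u) [Field L] [Algebra K L] :
    let := (sectionConstants π V).toAlgebra
    IrreducibleSpace (PrimeSpectrum (L ⊗[K] Γ(C, V))) := by
  let := (sectionConstants π V).toAlgebra
  have hcomp : hV.fromSpec ≫ π = Spec.map (CommRingCat.ofHom (algebraMap K Γ(C, V))) := by
    rw [← IsAffineOpen.SpecMap_appLE_fromSpec π (isAffineOpen_top _) hV le_top,
      IsAffineOpen.fromSpec_top, Scheme.isoSpec_Spec_inv, ← Spec.map_comp]
    rfl
  have : Surjective (hV.fromSpec ≫ π) := by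
    have : Subsingleton (Spec (.of K)) := inferInstanceAs (Subsingleton (PrimeSpectrum K))
    obtain ⟨x, hx⟩ := ‹Nonempty V›
    obtain ⟨y, -⟩ := hV.range_fromSpec.ge hx
    exact ⟨fun x ↦ ⟨y, Subsingleton.elim _ _⟩⟩
  have hgi : GeometricallyIrreducible (hV.fromSpec ≫ π) := inferInstance
  rw [hcomp] at hgi
  have h1 := hgi.geometrically_irreducibleSpace (Spec.map (CommRingCat.ofHom (algebraMap K L)))
    _ _ (IsPullback.of_hasPullback _ _).flip
  exact (pullbackSpecIso K L Γ(C, V)).hom.homeomorph.irreducibleSpace_iff.1 h1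

/-- The field `K` is separably closed in the function field of a geometrically irreducible
`K`-scheme. -/
lemma IsFunctionFieldOf.mem_range_of_isSeparable [IsIntegral C] [GeometricallyIrreducible π]
    (hF : IsFunctionFieldOf π F) {z : F} (hz : IsIntegral K z) (hsep : IsSeparable K z) :
    z ∈ (algebraMap K F).range := by
  obtain rfl | hz0 := eq_or_ne z 0
  · exact zero_mem _
  obtain ⟨e, he⟩ := hF
  -- A nonzero rational function spreads out to a section on a nonempty affine open.
  obtain ⟨V, hV, α, hV0, hα, -⟩ := exists_isUnit_germ_eq C (e z) (by simpa using hz0)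
  let := (sectionConstants π V).toAlgebra
  let := (sectionToField e V).toAlgebra
  have : IsScalarTower K Γ(C, V) F := .of_algebraMap_eq' (sectionToField_comp π he V).symm
  have := isFractionRing_sectionToField e hV
  have hαz : algebraMap Γ(C, V) F α = z := e.symm_apply_eq.2 hα
  have hinj := IsFractionRing.injective Γ(C, V) F
  have hm : minpoly K α = minpoly K z := by
    rw [← hαz, minpoly.algebraMap_eq hinj]
  have hint : IsIntegral K α := (isIntegral_algebraMap_iff hinj).1 (hαz ▸ hz)
  have := irreducibleSpace_tensorProduct π hV (AlgebraicClosure K)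
  obtain ⟨a, ha⟩ := mem_range_of_irreducibleSpace (AlgebraicClosure K) hint (hm ▸ hsep)
  exact ⟨a, by rw [← hαz, ← ha, ← IsScalarTower.algebraMap_apply]⟩

end EDS

theorem theoremC {K : Type u} [Field K] [DecidableEq K] (p : ℕ) [CharP K p]
    {C : Scheme.{u}} [IsIntegral C] (π : C ⟶ Spec (.of K))
    [SmoothOfRelativeDimension 1 π] [IsProper π] [GeometricallyIrreducible π]
    {F : Type u} [Field F] [DecidableEq F] [Algebra K F] (hF : EDS.IsFunctionFieldOf π F)
    (E : WeierstrassCurve K) [E.IsElliptic]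
    (P : (E.toAffine.baseChange F).Point)
    (hP : P ∉ Set.range (WeierstrassCurve.Affine.Point.baseChange (W' := E.toAffine) K F))
    (hinf : ¬ IsOfFinAddOrder P)
    (n : ℕ) (hn : 0 < n) :
    ((¬ p ∣ n ∨ EDS.IsOrdinary E) →
        EDS.HasPrimitiveValuation (EDS.eds K (E.toAffine.baseChange F) P) n) ∧
      (p ∣ n → EDS.IsSupersingular E →
        (∀ v : EDS.Place K F,
          EDS.eds K (E.toAffine.baseChange F) P n v =
            (p : ℚ) ^ 2 * EDS.eds K (E.toAffine.baseChange F) P (n / p) v) ∧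
        ¬ EDS.HasPrimitiveValuation (EDS.eds K (E.toAffine.baseChange F) P) n) := by
  obtain ⟨t, ht, hfin, hsep⟩ := hF.exists_finite_separable
  -- An element algebraic over K is separable over K(t), hence over K, hence constant.
  have halg (z : F) (hz : IsAlgebraic K z) : z ∈ (algebraMap K F).range :=
    hF.mem_range_of_isSeparable hz.isIntegral
      (EDS.isSeparable_of_isSeparable_adjoin ht hz.isIntegral (Algebra.IsSeparable.isSeparable _ z))
  exact EDS.primitiveValuation_of_isSeparable p hfin hsep halg P hP hinf n hn
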